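/- **Setting.** A partial function on a set $X$ is a set $f\subseteq X\times X$ with $(x,y),(x,z)\in f\Rightarrow y=z$. Let $\sigma$ be a signature with $\{\triangleright,\circ,\wedge\}\subseteq\sigma\subseteq\{\triangleright,\circ,\wedge,\text{update},\text{preferential union},\mathrm D,\mathrm A\}$. An algebra of partial functions of signature $\sigma$ is a nonempty set of partial functions, with base $X$ the union of all their domains and ranges, closed under the operations in $\sigma$, which are interpreted as follows. - $f\triangleright g=\{(x,y)\in g : x\notin\mathrm{dom}(f)\}$ (antidomain restriction). - $f\circ g=\{(x,z): \exists y\;(x,y)\in f,\ (y,z)\in g\}$ (composition). - $f\wedge g=f\cap g$. - The update $f[g]$ has domain $\mathrm{dom}(f)$; it takes the value of $g$ where $g$ is defined, and that of $f$ elsewhere. - The preferential union of $f$ and $g$ is $f\cup(f\triangleright g)$. - $\mathrm D(f)=\{(x,x):x\in\mathrm{dom}(f)\}$ and $\mathrm A(f)=\{(x,x):x\in X\setminus\mathrm{dom}(f)\}$. A $\sigma$-algebra is a nonempty set with operations interpreting the symbols of $\sigma$. A representation of a $\sigma$-algebra $\mathfrak A$ is an isomorphism $\theta$ from $\mathfrak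 A$ onto an algebra of partial functions of signature $\sigma$, and $\mathfrak A$ is representable if it has one. In a $\sigma$-algebra write $a\le b$ for $(a\triangleright b)\triangleright b=a$. In a representable algebra this is a partial order with least element $0=a\triangleright a$; joins, meets and atoms (minimal nonzero elements) refer to it. The atoms are separating if, whenever $a\not\le b$, there is an atom $c$ with $c\le a$ and $c\not\le b$. A representation $\theta$ is meet complete if $\theta(\bigwedge S)=\bigcap\theta[S]$ for every nonempty $S$ whose meet exists, and join complete if $\theta(\bigvee S)=\bigcup\theta[S]$ for every $S$ whose join exists. **Theorem.** For every such $\sigma$ there are a finite set $\Gamma$ of quasiequations and a single first-order sentence $\varphi$ of the form $\forall\cdots\forall\,\exists\cdots\exists\,\forall\cdots\forall\,\psi$ with $\psi$ quantifier-free, both in the language of $\sigma$, such that for every $\sigma$-algebra $\mathfrak A$: 1. $\mathfrak A\models\varphi$ if and only if $\mathfrak A$ has a meet-complete representation by partial functions, and also if and only if $\mathfrak A$ has a join-complete representation by partial functions. So the class of $\sigma$-algebras completely representable by partial functions is a basic elementary class, axiomatised by the $\forall\exists\forall$ sentence $\varphi$. 2. $\mathfrak A\models\Gamma$ if and only if $\mathfrak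 A$ is representable by partial functions. 3. $\mathfrak A\models\varphi$ if and only if $\mathfrak A\models\Gamma$, the atoms of $\mathfrak A$ are separating, and for all $a,b,c\in\mathfrak A$: if $a\circ x\le c$ for all atoms $x\le b$, then $a\circ b\le c$. 4. $\mathfrak A\models\varphi$ if and only if $\mathfrak A\models\Gamma$, the atoms of $\mathfrak A$ are separating, and composition is completely left-distributive over joins: whenever $S\subseteq\mathfrak A$ has a join, $a\circ\bigvee S$ is the join of $\{a\circ s: s\in S\}$ for every $a\in\mathfrak A$. -/

import Mathlib

open FirstOrder

universe u

namespace PartialFunctions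

/-! ### Operations on partial functions

A partial function on `X` is a functional relation, that is, a subset of `X × X`. -/

/-- A relation on `X` is a partial function on `X` if it is single-valued. -/
def IsPartialFunction {X : Type u} (f : SetRel X X) : Prop :=
  ∀ x y z, (x, y) ∈ f → (x, z) ∈ f → y = z

/-- The operation symbols, sorted by arity: antidomain restriction, composition, intersection,
update, preferential union, domain and antidomain. -/
inductive Op : ℕ → Type
  | arest : Op 2
  | compo : Op 2
  | inter : Op 2
  | update : Op 2
  | pref : Op 2
  | dom : Op 1
  | antidom : Op 1

/-- Antidomain restriction: `g` restricted to the points *not* in the domain of `f`. -/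
def arestRel {X : Type u} (f g : SetRel X X) : SetRel X X :=
  {p | p.1 ∉ f.dom ∧ p ∈ g}

/-- Composition, `f` first and then `g`. -/
def compRel {X : Type u} (f g : SetRel X X) : SetRel X X :=
  {p | ∃ y, (p.1, y) ∈ f ∧ (y, p.2) ∈ g}

/-- Update `f[g]`: defined where `f` is, with value that of `g` where `g` is defined as well, and
that of `f` otherwise. -/
def updateRel {X : Type u} (f g : SetRel X X) : SetRel X X :=
  {p | (p ∈ f ∧ p.1 ∉ g.dom) ∨ (p.1 ∈ f.dom ∧ p ∈ g)}

/-- Preferential union (override): `f` where `f` is defined, and `g` elsewhere. -/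
def prefRel {X : Type u} (f g : SetRel X X) : SetRel X X :=
  {p | p ∈ f ∨ (p.1 ∉ f.dom ∧ p ∈ g)}

/-- The identity function restricted to the domain of `f`. -/
def domRel {X : Type u} (f : SetRel X X) : SetRel X X :=
  {p | p.1 = p.2 ∧ p.1 ∈ f.dom}

/-- The identity function restricted to the points of the base where `f` is undefined. -/
def antidomRel {X : Type u} (f : SetRel X X) : SetRel X X :=
  {p | p.1 = p.2 ∧ p.1 ∉ f.dom}

/-- The set-theoretic interpretation of the operation symbols over the base `X`. -/
def Op.eval {X : Type u} : {n : ℕ} → Op n → (Fin n → SetRel X X) → SetRel X X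
  | _, .arest, v => arestRel (v 0) (v 1)
  | _, .compo, v => compRel (v 0) (v 1)
  | _, .inter, v => v 0 ∩ v 1
  | _, .update, v => updateRel (v 0) (v 1)
  | _, .pref, v => prefRel (v 0) (v 1)
  | _, .dom, v => domRel (v 0)
  | _, .antidom, v => antidomRel (v 0)

/-! ### Signatures and abstract algebras -/

/-- A signature: a set of operation symbols. -/
abbrev Signature := Set (Σ n, Op n)

/-- The first-order language of a signature `σ`: function symbols those in `σ`, no relation symbols
besides equality. A `σ`-algebra is a nonempty structure for this language. -/
def lang (σ : Signature) : FirstOrder.Language.{0, 0} where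
  Functions n := {o : Op n // (⟨n, o⟩ : Σ n, Op n) ∈ σ}
  Relations _ := Empty

/-- An operation symbol in `σ`, as a function symbol of the language of `σ`. -/
def lang.sym {σ : Signature} {n : ℕ} (o : Op n) (h : (⟨n, o⟩ : Σ n, Op n) ∈ σ) :
    (lang σ).Functions n :=
  ⟨o, h⟩

/-- A binary operation of a `σ`-algebra. -/
def op₂ {σ : Signature} {A : Type u} [(lang σ).Structure A] (o : Op 2)
    (h : (⟨2, o⟩ : Σ n, Op n) ∈ σ) (a b : A) : A :=
  FirstOrder.Language.Structure.funMap (lang.sym o h) ![a, b]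

/-! ### Algebras of partial functions and representations -/

/-- An algebra of partial functions of signature `σ`: a nonempty set of partial functions that is
closed under the operations in `σ`. The base consists of exactly the points that occur in the domain
or in the range of some element. -/
structure FunctionAlgebra (σ : Signature) where
  base : Type u
  carrier : Set (SetRel base base)
  nonempty : carrier.Nonempty
  functional : ∀ f ∈ carrier, IsPartialFunction f
  base_eq : ∀ x : base, ∃ f ∈ carrier, x ∈ f.dom ∨ x ∈ f.cod
  closed : ∀ (n : ℕ) (o : Op n), (⟨n, o⟩ : Σ n, Op n) ∈ σ →
    ∀ v : Fin n → SetRel base base, (∀ i, v i ∈ carrier) → o.eval v ∈ carrier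

instance FunctionAlgebra.instStructure {σ : Signature} (F : FunctionAlgebra.{u} σ) :
    (lang σ).Structure F.carrier where
  funMap {n} o v := ⟨o.1.eval fun i => (v i : SetRel F.base F.base),
    F.closed n o.1 o.2 _ fun i => (v i).2⟩
  RelMap r _ := nomatch r

/-- `A` has a representation, that is, an isomorphism onto an algebra of partial functions. -/
def Representable (σ : Signature) (A : Type u) [(lang σ).Structure A] : Prop :=
  ∃ F : FunctionAlgebra.{u} σ, Nonempty (A ≃[lang σ] F.carrier)

/-! ### The order, joins, meets and atoms of an algebra -/

section Order

variable {σ : Signature} {A : Type u} [(lang σ).Structure A]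
  (h : (⟨2, Op.arest⟩ : Σ n, Op n) ∈ σ)

/-- Domain restriction, as the term `(a ▷ b) ▷ b`. -/
def rest (a b : A) : A := op₂ .arest h (op₂ .arest h a b) b

/-- `a ≤ b` if and only if the domain restriction of `b` to `a` is `a`. -/
def Le (a b : A) : Prop := rest h a b = a

/-- `j` is the join (least upper bound) of `S`. -/
def IsJoin (S : Set A) (j : A) : Prop :=
  (∀ s ∈ S, Le h s j) ∧ ∀ b, (∀ s ∈ S, Le h s b) → Le h j b

/-- `m` is the meet (greatest lower bound) of `S`. -/
def IsMeet (S : Set A) (m : A) : Prop :=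
  (∀ s ∈ S, Le h m s) ∧ ∀ b, (∀ s ∈ S, Le h b s) → Le h b m

/-- `a` is the zero element, which in a representable algebra is the value of each term `a ▷ a`. -/
def IsZero (a : A) : Prop := op₂ .arest h a a = a

/-- An atom is a minimal nonzero element. -/
def IsAtomElt (x : A) : Prop :=
  ¬ IsZero h x ∧ ∀ y, ¬ IsZero h y → Le h y x → y = x

variable (A) in
/-- The atoms of `A` are separating. -/
def AtomsSeparating : Prop :=
  ∀ a b : A, ¬ Le h a b → ∃ c, IsAtomElt h c ∧ Le h c a ∧ ¬ Le h c b

variable (A) in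
/-- Composition is completely left-distributive over joins. -/
def CompLeftDistribJoins (hc : (⟨2, Op.compo⟩ : Σ n, Op n) ∈ σ) : Prop :=
  ∀ (S : Set A) (j a : A), IsJoin h S j → IsJoin h (op₂ .compo hc a '' S) (op₂ .compo hc a j)

variable (A) in
/-- The first-order form of complete left-distributivity of composition over joins: if `c` is above
`a ∘ x` for all atoms `x` below `b`, then `c` is above `a ∘ b`. -/
def CompLeftDistribAtoms (hc : (⟨2, Op.compo⟩ : Σ n, Op n) ∈ σ) : Prop :=
  ∀ a b c : A, (∀ x, IsAtomElt h x → Le h x b → Le h (op₂ .compo hc a x) c) →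
    Le h (op₂ .compo hc a b) c

/-! ### Complete representations -/

/-- A representation is meet complete if it turns every existing meet of a nonempty set into an
intersection. -/
def IsMeetComplete {F : FunctionAlgebra.{u} σ} (θ : A ≃[lang σ] F.carrier) : Prop :=
  ∀ (S : Set A) (m : A), S.Nonempty → IsMeet h S m →
    (θ m : SetRel F.base F.base) = ⋂ s ∈ S, (θ s : SetRel F.base F.base)

/-- A representation is join complete if it turns every existing join into a union. -/
def IsJoinComplete {F : FunctionAlgebra.{u} σ} (θ : A ≃[lang σ] F.carrier) : Prop :=
  ∀ (S : Set A) (j : A), IsJoin h S j →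
    (θ j : SetRel F.base F.base) = ⋃ s ∈ S, (θ s : SetRel F.base F.base)

variable (A) in
/-- `A` has a meet-complete representation by partial functions. -/
def MeetCompletelyRepresentable : Prop :=
  ∃ (F : FunctionAlgebra.{u} σ) (θ : A ≃[lang σ] F.carrier), IsMeetComplete h θ

variable (A) in
/-- `A` has a join-complete representation by partial functions. -/
def JoinCompletelyRepresentable : Prop :=
  ∃ (F : FunctionAlgebra.{u} σ) (θ : A ≃[lang σ] F.carrier), IsJoinComplete h θ

end Order

/-! ### Syntactic forms of sentences -/

section Sentences

variable {L : FirstOrder.Language.{0, 0}}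

/-- Formulas consisting of a block of existential quantifiers and a block of universal quantifiers
in front of a quantifier-free formula. -/
inductive IsExistsForall : ∀ {n : ℕ}, L.BoundedFormula Empty n → Prop
  | of_isUniversal {n : ℕ} {ψ : L.BoundedFormula Empty n} (hψ : ψ.IsUniversal) : IsExistsForall ψ
  | ex {n : ℕ} {ψ : L.BoundedFormula Empty (n + 1)} (hψ : IsExistsForall ψ) : IsExistsForall ψ.ex

/-- Formulas consisting of a block of universal, a block of existential and a block of universal
quantifiers in front of a quantifier-free formula. -/
inductive IsForallExistsForall : ∀ {n : ℕ}, L.BoundedFormula Empty n → Prop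
  | of_isExistsForall {n : ℕ} {ψ : L.BoundedFormula Empty n} (hψ : IsExistsForall ψ) :
      IsForallExistsForall ψ
  | all {n : ℕ} {ψ : L.BoundedFormula Empty (n + 1)} (hψ : IsForallExistsForall ψ) :
      IsForallExistsForall ψ.all

/-- Quasiequations: universally quantified implications whose premises form a finite (possibly
empty) list of equations between terms and whose conclusion is an equation between terms. -/
def IsQuasiequation (γ : L.Sentence) : Prop :=
  ∃ (n : ℕ) (P : List (L.Term (Empty ⊕ Fin n) × L.Term (Empty ⊕ Fin n)))
    (s t : L.Term (Empty ⊕ Fin n)),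
    γ = (P.foldr (fun p ψ => (p.1.bdEqual p.2).imp ψ) (s.bdEqual t)).alls

end Sentences

end PartialFunctions

/-! Write `r`, `m`, `c` for antidomain restriction, intersection and composition. Inclusion of the
domain of `a` in that of `b` is the equation "`r b a` is zero", so the needed facts about domains
can be stated as equations, and finitely many of them define the representable algebras. An algebra
satisfying them acts on germs: a point is an ultrafilter `x` of domains with the class of an element
`p` defined at `x`, where `p` and `q` are identified when `m p q ∈ x`. An element `b` sends the germ
of `p` to that of `p ∘ b`, if `p ∘ b` is defined at `x`. The laws rewrite `p ∘ _` applied to any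
operation, so each operation is checked at a single ultrafilter (`SatisfiesLaws.isRep_germRep`).
Zorn's lemma supplies enough ultrafilters (`CoreLaws.exists_ultra`), and local identities make the
action faithful.

Relative complement `(a ∧ b) ▷ a` exchanges meets and joins, so meet-complete and join-complete
representations coincide. Join completeness forces separating atoms (`IsRep.atomsSeparating`), and
then left-distributivity over the atoms below an element. Conversely, with separating atoms the
ultrafilters generated by atoms already suffice for a faithful action, and left-distributivity makes
it join complete (`SatisfiesLaws.exists_joinComplete`). Separation and distributivity over atoms are
first-order, and together with the equations they fit into one ∀∃∀ sentence. -/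

namespace PartialFunctions

/-! ### Equational laws and ultrafilters of domains -/

section Laws

variable {A : Type u}

/-- Equations for antidomain restriction `r`, intersection `m` and composition `c`. The terms
`r a a` all denote the empty function, so that `r b a = r a a` says that the domain of `a` is
contained in that of `b`. -/
structure CoreLaws (r m c : A → A → A) : Prop where
  self : ∀ a b, r a a = r b b
  self_left : ∀ a b, r (r a a) b = b
  trans : ∀ x y z, r (r z y) (r (r y x) (r z x)) = r x x
  inter : ∀ x y z, r (r x z) (r (r y z) (r (r (r x y) y) z)) = r x x
  right : ∀ x y, r y (r x y) = r x x
  disjoint : ∀ x y, r (r x (r x y)) (r x y) = r x x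
  rest_left : ∀ x y, r x (r (r x y) y) = r x x
  mono_left : ∀ x y z, r (r x y) (r x (r (r y z) z)) = r x x
  mono_right : ∀ x y z, r (r x z) (r x (r (r y z) z)) = r x x
  inf_self : ∀ x, m x x = x
  inf_comm : ∀ x y, m x y = m y x
  inf_dom : ∀ x y, r x (m x y) = r x x
  inf_inf : ∀ x y, m (m x y) x = m x y
  inf_rest : ∀ x y, r (r (m x y) x) x = m x y
  inf_trans : ∀ x y z, r (m x z) (r (r (m x y) (m y z)) (m y z)) = r x x
  arest_inf : ∀ x y, m (r x y) y = r x y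
  assoc : ∀ x y z, c (c x y) z = c x (c y z)
  comp_dom : ∀ x y, r x (c x y) = r x x
  comp_arest : ∀ x y z, c x (r y z) = r (c x y) (c x z)
  comp_inf : ∀ x y z, c x (m y z) = m (c x y) (c x z)
  inf_comp : ∀ x y z, r (m (c x z) (c y z)) (r (r (m x y) (c x z)) (c x z)) = r x x

/-- Equations for update. -/
structure UpdateLaws (r m c t : A → A → A) : Prop where
  comp : ∀ x y z, c x (t y z) = t (c x y) (c x z)
  dom_le : ∀ x y, r x (t x y) = r x x
  le_dom : ∀ x y, r (t x y) x = r x x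
  eq_right : ∀ x y, r (m (t x y) y) (r (r x y) y) = r x x
  eq_left : ∀ x y, r (m (t x y) x) (r y x) = r x x

/-- Equations for preferential union. -/
structure PrefLaws (r m c t : A → A → A) : Prop where
  comp : ∀ x y z, c x (t y z) = t (c x y) (c x z)
  eq_left : ∀ x y, r (m (t x y) x) x = r x x
  eq_right : ∀ x y, r (m (t x y) y) (r x y) = r x x
  dom_le : ∀ x y, r y (r x (t x y)) = r x x

/-- Equations for domain. -/
structure DomLaws (r m c : A → A → A) (d : A → A) : Prop where
  comp : ∀ x y, c x (d y) = r (r (c x y) x) x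
  dom_comp : ∀ x, c (d x) x = x
  le_dom : ∀ x, r (d x) x = r x x
  eq_of_comp : ∀ x y, r (m x y) (m (c (d x) y) x) = r x x

/-- Equations for antidomain. -/
structure AntidomLaws (r c : A → A → A) (d : A → A) : Prop where
  comp : ∀ x y, c x (d y) = r (c x y) x
  one_comp : ∀ x y, c (d (r x x)) y = y
  le_one : ∀ x y, r (d (r x x)) y = r x x

/-- Ultrafilters of the domains of the elements of an algebra. -/
structure IsUltra (r : A → A → A) (x : Set A) : Prop where
  nonempty : x.Nonempty
  zero : ∀ a, r a a ∉ x
  up : ∀ {a b}, a ∈ x → ∀ e, r b a = r e e → b ∈ x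
  inter : ∀ {a b}, a ∈ x → b ∈ x → r (r a b) b ∈ x
  prime : ∀ {a b}, b ∈ x → a ∉ x → r a b ∈ x

variable {r m c : A → A → A}

/-- The law `trans` encodes this implication as an equation: once both premises hold, its
restricting terms are zero and `self_left` removes them. `domLE_inter` works in the same way. -/
theorem CoreLaws.domLE_trans (L : CoreLaws r m c) {x y z e : A} (h₁ : r y x = r e e)
    (h₂ : r z y = r e e) : r z x = r e e := by
  have := L.trans x y z
  rw [h₁, h₂, L.self_left, L.self_left] at this
  rw [this, L.self x e]

theorem CoreLaws.domLE_inter (L : CoreLaws r m c) {x y z e : A} (h₁ : r x z = r e e)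
    (h₂ : r y z = r e e) : r (r (r x y) y) z = r e e := by
  have := L.inter x y z
  rw [h₁, h₂, L.self_left, L.self_left] at this
  rw [this, L.self x e]

/-- Zorn's lemma on proper filters for the domain preorder, starting from the principal filter of
`a`. Primeness of a maximal filter comes from adjoining the complement of the domain of `b`. -/
theorem CoreLaws.exists_ultra (L : CoreLaws r m c) {a : A} (ha : r a a ≠ a) :
    ∃ x, IsUltra r x ∧ a ∈ x := by
  set F : Set (Set A) := {x | (∀ b, r b b ∉ x) ∧ (∀ b d, b ∈ x → r d b = r a a → d ∈ x) ∧
    ∀ b d, b ∈ x → d ∈ x → r (r b d) d ∈ x} with hF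
  have hmem : {b | r b a = r a a} ∈ F := by
    refine ⟨fun b hb => ha ?_, fun b d hb hd => L.domLE_trans hb hd,
      fun b d hb hd => L.domLE_inter hb hd⟩
    rw [Set.mem_ofPred_eq, L.self_left] at hb
    exact hb.symm
  obtain ⟨x, hx, hmax⟩ := zorn_subset_nonempty F (fun C hC hchain hne => by
    refine ⟨⋃₀ C, ⟨?_, ?_, ?_⟩, fun s hs => Set.subset_sUnion_of_mem hs⟩
    · rintro b ⟨s, hs, hb⟩
      exact (hC hs).1 b hb
    · rintro b d ⟨s, hs, hb⟩ hd
      exact ⟨s, hs, (hC hs).2.1 b d hb hd⟩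
    · rintro b d ⟨s, hs, hb⟩ ⟨t, ht, hd⟩
      rcases hchain.total hs ht with h | h
      · exact ⟨t, ht, (hC ht).2.2 b d (h hb) hd⟩
      · exact ⟨s, hs, (hC hs).2.2 b d hb (h hd)⟩) _ hmem
  have hax : a ∈ x := hx (show r a a = r a a from rfl)
  obtain ⟨hz, hup, hint⟩ := hmax.prop
  refine ⟨x, ⟨⟨a, hax⟩, hz, fun {b d} hb e hd => hup b d hb (hd.trans (L.self _ _)),
    fun {b d} hb hd => hint b d hb hd, fun {b d} hd hb => ?_⟩, hax⟩
  -- The filter generated by `x` and the complement of `b`. It is proper: if it contained zero, some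
  -- `f ∈ x` would have its domain inside that of `b`, forcing `b ∈ x`.
  have hG : {e | ∃ f ∈ x, r e (r b f) = r a a} ∈ F := by
    refine ⟨?_, ?_, ?_⟩
    · rintro e ⟨f, hf, he⟩
      rw [L.self_left] at he
      exact hb (hup f b hf he)
    · rintro e g ⟨f, hf, he⟩ hg
      exact ⟨f, hf, L.domLE_trans he hg⟩
    · rintro e g ⟨f, hf, he⟩ ⟨f', hf', hg⟩
      exact ⟨_, hint f f' hf hf', L.domLE_inter
        (L.domLE_trans ((L.mono_left b f f').trans (L.self _ _)) he)
        (L.domLE_trans ((L.mono_right b f f').trans (L.self _ _)) hg)⟩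
  have hsub : x ⊆ {e | ∃ f ∈ x, r e (r b f) = r a a} := fun e he =>
    ⟨e, he, (L.right b e).trans (L.self _ _)⟩
  exact hmax.le_of_ge hG hsub ⟨d, hd, L.self _ _⟩

end Laws

/-! ### Representation by germs -/

section Germs

variable {A : Type u}

/-- Action of an algebra on itself with an identity element adjoined. -/
def act (c : A → A → A) : Option A → A → A
  | none, b => b
  | some a, b => c a b

/-- The adjoined identity is regarded as defined everywhere. -/
def DefinedAt (x : Set A) : Option A → Prop
  | none => True
  | some a => a ∈ x

/-- Equality of germs at `x`. -/
def GermEq (m : A → A → A) (x : Set A) : Option A → Option A → Prop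
  | none, none => True
  | some a, some b => m a b ∈ x
  | _, _ => False

/-- The germ of `p` at `x`. -/
def germ (m : A → A → A) (x : Set A) (p : Option A) : Set (Option A) :=
  {q | GermEq m x p q}

/-- Pairs consisting of an ultrafilter in `𝒳` and the germ at it of an element of `P`. -/
abbrev GermBase (m : A → A → A) (𝒳 : Set (Set A)) (P : Set (Option A)) : Type u :=
  {w : Set A × Set (Option A) // w.1 ∈ 𝒳 ∧ ∃ p ∈ P, DefinedAt w.1 p ∧ w.2 = germ m w.1 p}

/-- The action of the elements of an algebra on germs. -/
def germRep (m c : A → A → A) (𝒳 : Set (Set A)) (P : Set (Option A)) (b : A) :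
    SetRel (GermBase m 𝒳 P) (GermBase m 𝒳 P) :=
  {w | ∃ p ∈ P, DefinedAt w.1.1.1 p ∧ w.1.1.2 = germ m w.1.1.1 p ∧ act c p b ∈ w.1.1.1 ∧
    w.2.1 = (w.1.1.1, germ m w.1.1.1 (some (act c p b)))}

variable {r m c : A → A → A} {𝒳 : Set (Set A)} {P : Set (Option A)} {x : Set A}

theorem CoreLaws.inf_mem_left (L : CoreLaws r m c) (U : IsUltra r x) {a b : A} (h : m a b ∈ x) :
    a ∈ x :=
  U.up h _ (L.inf_dom a b)

theorem CoreLaws.inf_mem_right (L : CoreLaws r m c) (U : IsUltra r x) {a b : A} (h : m a b ∈ x) :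
    b ∈ x :=
  L.inf_mem_left U (L.inf_comm a b ▸ h)

theorem CoreLaws.inf_mem_trans (L : CoreLaws r m c) (U : IsUltra r x) {a b d : A}
    (h : m a b ∈ x) (h' : m b d ∈ x) : m a d ∈ x :=
  U.up (U.inter h h') _ (L.inf_trans a b d)

theorem CoreLaws.arest_mem_iff (L : CoreLaws r m c) (U : IsUltra r x) {a b : A} :
    r a b ∈ x ↔ a ∉ x ∧ b ∈ x := by
  refine ⟨fun h => ⟨fun ha => ?_, U.up h _ (L.right a b)⟩, fun h => U.prime h.2 h.1⟩
  have := U.inter ha h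
  rw [L.disjoint] at this
  exact U.zero _ this

/-- Definedness of `p` matters: an element not in `x` has empty germ, so all undefined elements
share one germ. -/
theorem CoreLaws.germEq_iff (L : CoreLaws r m c) (U : IsUltra r x) {p q : Option A}
    (hp : DefinedAt x p) : germ m x p = germ m x q ↔ GermEq m x q p := by
  constructor
  · intro h
    have : p ∈ germ m x p := by
      cases p with
      | none => trivial
      | some a => exact show m a a ∈ x from (L.inf_self a).symm ▸ hp
    rw [h] at this
    exact this
  · intro h
    ext s
    rcases p with _ | a <;> rcases q with _ | b <;> rcases s with _ | d <;>
      simp only [GermEq, germ, Set.mem_ofPred_eq] at h ⊢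
    exact ⟨L.inf_mem_trans U h, L.inf_mem_trans U (L.inf_comm b a ▸ h)⟩

theorem CoreLaws.germ_some_eq_iff (L : CoreLaws r m c) (U : IsUltra r x) {a b : A}
    (ha : a ∈ x) : germ m x (some a) = germ m x (some b) ↔ m a b ∈ x := by
  rw [L.germEq_iff U (p := some a) ha, GermEq, L.inf_comm]

theorem CoreLaws.inf_act_mem (L : CoreLaws r m c) (U : IsUltra r x) {p q : Option A} {b : A}
    (h : GermEq m x p q) (hp : act c p b ∈ x) : m (act c p b) (act c q b) ∈ x := by
  rcases p with _ | a <;> rcases q with _ | d <;> simp only [GermEq, act] at h hp ⊢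
  · rwa [L.inf_self]
  · exact U.up (U.inter h hp) _ (L.inf_comp a d b)

/-- The point of the base given by an ultrafilter and an element that is defined there. -/
def GermBase.mk (m : A → A → A) (hx : x ∈ 𝒳) (p : Option A) (hp : p ∈ P) (hd : DefinedAt x p) :
    GermBase m 𝒳 P :=
  ⟨(x, germ m x p), hx, p, hp, hd, rfl⟩

theorem GermBase.exists_mk (w : GermBase m 𝒳 P) :
    ∃ (x : Set A) (hx : x ∈ 𝒳) (p : Option A) (hp : p ∈ P) (hd : DefinedAt x p),
      w = GermBase.mk m hx p hp hd := by
  obtain ⟨⟨x, s⟩, hx, p, hp, hd, hs⟩ := w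
  exact ⟨x, hx, p, hp, hd, Subtype.ext (Prod.ext rfl hs)⟩

/-- The action does not depend on the representative of the germ, since by `inf_comp` elements that
agree at `x` have images under `b` that agree there. This reduces every later verification to
membership in `x`. -/
theorem CoreLaws.mem_germRep (L : CoreLaws r m c) (h𝒳 : ∀ x ∈ 𝒳, IsUltra r x) {hx : x ∈ 𝒳}
    {p : Option A} {hp : p ∈ P} {hd : DefinedAt x p} {w : GermBase m 𝒳 P} {b : A} :
    (GermBase.mk m hx p hp hd, w) ∈ germRep m c 𝒳 P b ↔
      act c p b ∈ x ∧ w.1 = (x, germ m x (some (act c p b))) := by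
  have U := h𝒳 x hx
  constructor
  · rintro ⟨q, -, hq, hpq, hqb, hw⟩
    change germ m x p = germ m x q at hpq
    change act c q b ∈ x at hqb
    change w.1 = (x, germ m x (some (act c q b))) at hw
    have := L.inf_act_mem U ((L.germEq_iff U hd).1 hpq) hqb
    exact ⟨L.inf_mem_right U this, by rw [hw, (L.germ_some_eq_iff U hqb).2 this]⟩
  · rintro ⟨hb, hw⟩
    exact ⟨p, hp, hd, rfl, hb, hw⟩

theorem CoreLaws.mem_dom_germRep (L : CoreLaws r m c) (h𝒳 : ∀ x ∈ 𝒳, IsUltra r x)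
    (hP : ∀ a, some a ∈ P) {hx : x ∈ 𝒳}
    {p : Option A} {hp : p ∈ P} {hd : DefinedAt x p} {b : A} :
    GermBase.mk m hx p hp hd ∈ (germRep m c 𝒳 P b).dom ↔ act c p b ∈ x := by
  constructor
  · rintro ⟨w, hw⟩
    exact ((L.mem_germRep h𝒳).1 hw).1
  · intro h
    exact ⟨GermBase.mk m hx (some (act c p b)) (hP _) h, (L.mem_germRep h𝒳).2 ⟨h, rfl⟩⟩

theorem CoreLaws.isPartialFunction_germRep (L : CoreLaws r m c) (h𝒳 : ∀ x ∈ 𝒳, IsUltra r x)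
    (b : A) : IsPartialFunction (germRep m c 𝒳 P b) := by
  intro w v v' h h'
  obtain ⟨x, hx, p, hp, hd, rfl⟩ := w.exists_mk
  rw [L.mem_germRep h𝒳] at h h'
  exact Subtype.ext (h.2.trans h'.2.symm)

theorem CoreLaws.act_comp (L : CoreLaws r m c) (p : Option A) (a b : A) :
    act c p (c a b) = c (act c p a) b := by
  cases p with
  | none => rfl
  | some d => exact (L.assoc d a b).symm

theorem CoreLaws.act_arest (L : CoreLaws r m c) (p : Option A) (a b : A) :
    act c p (r a b) = r (act c p a) (act c p b) := by
  cases p with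
  | none => rfl
  | some d => exact L.comp_arest d a b

theorem CoreLaws.act_inf (L : CoreLaws r m c) (p : Option A) (a b : A) :
    act c p (m a b) = m (act c p a) (act c p b) := by
  cases p with
  | none => rfl
  | some d => exact L.comp_inf d a b

theorem act_of_comp {t : A → A → A} (h : ∀ x y z, c x (t y z) = t (c x y) (c x z))
    (p : Option A) (a b : A) : act c p (t a b) = t (act c p a) (act c p b) := by
  cases p with
  | none => rfl
  | some d => exact h d a b

theorem CoreLaws.germRep_arest (L : CoreLaws r m c) (h𝒳 : ∀ x ∈ 𝒳, IsUltra r x)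
    (hP : ∀ a, some a ∈ P) (a b : A) :
    germRep m c 𝒳 P (r a b) = arestRel (germRep m c 𝒳 P a) (germRep m c 𝒳 P b) := by
  ext ⟨w, v⟩
  obtain ⟨x, hx, p, hp, hd, rfl⟩ := w.exists_mk
  have U := h𝒳 x hx
  simp only [arestRel, Set.mem_ofPred_eq]
  rw [L.mem_germRep h𝒳, L.mem_germRep h𝒳, L.mem_dom_germRep h𝒳 hP, L.act_arest,
    L.arest_mem_iff U, and_assoc]
  refine and_congr_right fun ha => and_congr_right fun hb => ?_
  rw [(L.germ_some_eq_iff U ((L.arest_mem_iff U).2 ⟨ha, hb⟩)).2]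
  rw [L.arest_inf]
  exact (L.arest_mem_iff U).2 ⟨ha, hb⟩

theorem CoreLaws.germRep_inf (L : CoreLaws r m c) (h𝒳 : ∀ x ∈ 𝒳, IsUltra r x) (a b : A) :
    germRep m c 𝒳 P (m a b) = germRep m c 𝒳 P a ∩ germRep m c 𝒳 P b := by
  ext ⟨w, v⟩
  obtain ⟨x, hx, p, hp, hd, rfl⟩ := w.exists_mk
  have U := h𝒳 x hx
  rw [Set.mem_inter_iff, L.mem_germRep h𝒳, L.mem_germRep h𝒳, L.mem_germRep h𝒳, L.act_inf]
  constructor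
  · rintro ⟨h, hv⟩
    have ha := (L.germ_some_eq_iff U (b := act c p a) h).2 (by rwa [L.inf_inf])
    have hb := (L.germ_some_eq_iff U (b := act c p b) h).2
      (by rwa [L.inf_comm (act c p a), L.inf_inf, L.inf_comm])
    exact ⟨⟨L.inf_mem_left U h, ha ▸ hv⟩, L.inf_mem_right U h, hb ▸ hv⟩
  · rintro ⟨⟨ha, hv⟩, hb, hv'⟩
    have h := (L.germ_some_eq_iff U ha).1 (Prod.ext_iff.1 (hv.symm.trans hv')).2
    refine ⟨h, hv.trans ?_⟩
    rw [(L.germ_some_eq_iff U (b := act c p a) h).2 (by rwa [L.inf_inf])]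

theorem CoreLaws.germRep_comp (L : CoreLaws r m c) (h𝒳 : ∀ x ∈ 𝒳, IsUltra r x)
    (hP : ∀ a, some a ∈ P) (a b : A) :
    germRep m c 𝒳 P (c a b) = compRel (germRep m c 𝒳 P a) (germRep m c 𝒳 P b) := by
  ext ⟨w, v⟩
  obtain ⟨x, hx, p, hp, hd, rfl⟩ := w.exists_mk
  have U := h𝒳 x hx
  simp only [compRel, Set.mem_ofPred_eq]
  rw [L.mem_germRep h𝒳, L.act_comp]
  constructor
  · rintro ⟨h, hv⟩
    have ha : act c p a ∈ x := U.up h _ (L.comp_dom _ _)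
    exact ⟨GermBase.mk m hx (some (act c p a)) (hP _) ha, (L.mem_germRep h𝒳).2 ⟨ha, rfl⟩,
      (L.mem_germRep h𝒳).2 ⟨h, hv⟩⟩
  · rintro ⟨w', h, h'⟩
    obtain ⟨ha, hw⟩ := (L.mem_germRep h𝒳).1 h
    obtain rfl : w' = GermBase.mk m hx (some (act c p a)) (hP _) ha := Subtype.ext hw
    exact (L.mem_germRep h𝒳).1 h'

/-- After `p` is distributed over update, only two elements at a fixed ultrafilter remain. Primeness
decides which of the laws `eq_right` and `eq_left` gives the germ of the update. -/
theorem CoreLaws.germRep_update (L : CoreLaws r m c) {t : A → A → A} (T : UpdateLaws r m c t)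
    (h𝒳 : ∀ x ∈ 𝒳, IsUltra r x) (hP : ∀ a, some a ∈ P) (a b : A) :
    germRep m c 𝒳 P (t a b) = updateRel (germRep m c 𝒳 P a) (germRep m c 𝒳 P b) := by
  ext ⟨w, v⟩
  obtain ⟨x, hx, p, hp, hd, rfl⟩ := w.exists_mk
  have U := h𝒳 x hx
  simp only [updateRel, Set.mem_ofPred_eq]
  rw [L.mem_germRep h𝒳, L.mem_germRep h𝒳, L.mem_germRep h𝒳, L.mem_dom_germRep h𝒳 hP,
    L.mem_dom_germRep h𝒳 hP, act_of_comp T.comp]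
  generalize act c p a = a
  generalize act c p b = b
  have hdom : t a b ∈ x ↔ a ∈ x :=
    ⟨fun h => U.up h _ (T.dom_le a b), fun h => U.up h _ (T.le_dom a b)⟩
  by_cases ha : a ∈ x
  · have ht := hdom.2 ha
    by_cases hb : b ∈ x
    · rw [(L.germ_some_eq_iff U ht).2 (U.up (U.inter ha hb) _ (T.eq_right a b))]
      tauto
    · rw [(L.germ_some_eq_iff U ht).2 (U.up (U.prime ha hb) _ (T.eq_left a b))]
      tauto
  · tauto

theorem CoreLaws.germRep_pref (L : CoreLaws r m c) {t : A → A → A} (T : PrefLaws r m c t)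
    (h𝒳 : ∀ x ∈ 𝒳, IsUltra r x) (hP : ∀ a, some a ∈ P) (a b : A) :
    germRep m c 𝒳 P (t a b) = prefRel (germRep m c 𝒳 P a) (germRep m c 𝒳 P b) := by
  ext ⟨w, v⟩
  obtain ⟨x, hx, p, hp, hd, rfl⟩ := w.exists_mk
  have U := h𝒳 x hx
  simp only [prefRel, Set.mem_ofPred_eq]
  rw [L.mem_germRep h𝒳, L.mem_germRep h𝒳, L.mem_germRep h𝒳, L.mem_dom_germRep h𝒳 hP,
    act_of_comp T.comp]
  generalize act c p a = a
  generalize act c p b = b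
  by_cases ha : a ∈ x
  · have h := U.up ha _ (T.eq_left a b)
    rw [(L.germ_some_eq_iff U (L.inf_mem_left U h)).2 h]
    have := L.inf_mem_left U h
    tauto
  · by_cases hb : b ∈ x
    · have h := U.up (U.prime hb ha) _ (T.eq_right a b)
      rw [(L.germ_some_eq_iff U (L.inf_mem_left U h)).2 h]
      have := L.inf_mem_left U h
      tauto
    · have : t a b ∉ x := fun h => hb (U.up (U.prime h ha) _ (T.dom_le a b))
      tauto

/-- At the germ of `b`, the law `comp` makes `D(a)` act as restriction of `b` to the domain of `b ∘
a`, which has the same germ as `b`. The adjoined identity must be excluded: its germ differs from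
that of every element, so `D(a)` would move that point. -/
theorem CoreLaws.germRep_dom (L : CoreLaws r m c) {d : A → A} (T : DomLaws r m c d)
    (h𝒳 : ∀ x ∈ 𝒳, IsUltra r x) (hP : ∀ a, some a ∈ P) (hP' : none ∉ P) (a : A) :
    germRep m c 𝒳 P (d a) = domRel (germRep m c 𝒳 P a) := by
  ext ⟨w, v⟩
  obtain ⟨x, hx, p, hp, hd, rfl⟩ := w.exists_mk
  have U := h𝒳 x hx
  simp only [domRel, Set.mem_ofPred_eq]
  rw [L.mem_germRep h𝒳, L.mem_dom_germRep h𝒳 hP]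
  obtain _ | b := p
  · exact absurd hp hP'
  change c b (d a) ∈ x ∧ v.1 = (x, germ m x (some (c b (d a)))) ↔ _ ∧ c b a ∈ x
  rw [T.comp]
  have hmem : r (r (c b a) b) b ∈ x ↔ c b a ∈ x :=
    ⟨fun h => U.up h _ (L.rest_left _ _), fun h => U.inter h hd⟩
  rw [hmem, and_comm]
  refine and_congr_left fun h => ?_
  rw [(L.germ_some_eq_iff U (hmem.2 h)).2 (by rw [L.arest_inf]; exact hmem.2 h)]
  exact ⟨fun h => (Subtype.ext h).symm, fun h => congrArg Subtype.val h.symm⟩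

theorem CoreLaws.germRep_antidom (L : CoreLaws r m c) {d : A → A} (T : AntidomLaws r c d)
    (h𝒳 : ∀ x ∈ 𝒳, IsUltra r x) (hP : ∀ a, some a ∈ P) (hP' : none ∉ P) (a : A) :
    germRep m c 𝒳 P (d a) = antidomRel (germRep m c 𝒳 P a) := by
  ext ⟨w, v⟩
  obtain ⟨x, hx, p, hp, hd, rfl⟩ := w.exists_mk
  have U := h𝒳 x hx
  simp only [antidomRel, Set.mem_ofPred_eq]
  rw [L.mem_germRep h𝒳, L.mem_dom_germRep h𝒳 hP]
  obtain _ | b := p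
  · exact absurd hp hP'
  change c b (d a) ∈ x ∧ v.1 = (x, germ m x (some (c b (d a)))) ↔ _ ∧ c b a ∉ x
  rw [T.comp]
  have hmem : r (c b a) b ∈ x ↔ c b a ∉ x :=
    ⟨fun h => ((L.arest_mem_iff U).1 h).1, fun h => U.prime hd h⟩
  rw [hmem, and_comm]
  refine and_congr_left fun h => ?_
  rw [(L.germ_some_eq_iff U (hmem.2 h)).2 (by rw [L.arest_inf]; exact hmem.2 h)]
  exact ⟨fun h => (Subtype.ext h).symm, fun h => congrArg Subtype.val h.symm⟩

/-- `P` contains a local identity for each element. -/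
def HasLocalIdentities (r m c : A → A → A) (P : Set (Option A)) : Prop :=
  ∀ a, ∃ p ∈ P, act c p a = a ∧ ∀ x, IsUltra r x → a ∈ x →
    DefinedAt x p ∧ ∀ b, m (act c p b) a ∈ x → m a b ∈ x

/-- If `a` and `b` differ on a nonempty domain, some `x ∈ 𝒳` contains `a` but not `m a b`. A local
identity of `a` at `x` is a point that `a` sends to the germ of `a`, whereas `b` does not. -/
theorem CoreLaws.injective_germRep (L : CoreLaws r m c) (h𝒳 : ∀ x ∈ 𝒳, IsUltra r x)
    (hP : ∀ a, some a ∈ P) (hI : HasLocalIdentities r m c P)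
    (hsep : ∀ a, r a a ≠ a → ∃ x ∈ 𝒳, a ∈ x) : Function.Injective (germRep m c 𝒳 P) := by
  have key : ∀ a b, germRep m c 𝒳 P a = germRep m c 𝒳 P b → m a b = a := by
    intro a b hab
    by_contra hne
    -- By `inf_rest`, if `r (m a b) a` were zero then `m a b = a`.
    obtain ⟨x, hx, hmem⟩ := hsep (r (m a b) a) fun h => hne <| by
      rw [← L.inf_rest a b, ← h, L.self_left]
    have U := h𝒳 x hx
    obtain ⟨hm, ha⟩ := (L.arest_mem_iff U).1 hmem
    obtain ⟨p, hp, hpa, hpx⟩ := hI a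
    obtain ⟨hd, hb⟩ := hpx x U ha
    have h₁ : (GermBase.mk m hx p hp hd, GermBase.mk m hx (some a) (hP a) ha) ∈
        germRep m c 𝒳 P a := (L.mem_germRep h𝒳).2 (by rw [hpa]; exact ⟨ha, rfl⟩)
    rw [hab, L.mem_germRep h𝒳] at h₁
    have h₂ := (L.germ_some_eq_iff U ha).1 (Prod.ext_iff.1 h₁.2).2
    exact hm (hb b (L.inf_comm a _ ▸ h₂))
  intro a b hab
  rw [← key a b hab, L.inf_comm, key b a hab.symm]

theorem CoreLaws.germBase_covered (L : CoreLaws r m c) (h𝒳 : ∀ x ∈ 𝒳, IsUltra r x)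
    (hP : ∀ a, some a ∈ P) (hI : HasLocalIdentities r m c P) (w : GermBase m 𝒳 P) :
    ∃ a, w ∈ (germRep m c 𝒳 P a).dom ∨ w ∈ (germRep m c 𝒳 P a).cod := by
  obtain ⟨x, hx, p, hp, hd, rfl⟩ := w.exists_mk
  have U := h𝒳 x hx
  obtain _ | a := p
  · obtain ⟨a, ha⟩ := U.nonempty
    exact ⟨a, Or.inl ((L.mem_dom_germRep h𝒳 hP).2 ha)⟩
  · obtain ⟨q, hq, hqa, hqx⟩ := hI a
    exact ⟨a, Or.inr ⟨GermBase.mk m hx q hq (hqx x U hd).1,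
      (L.mem_germRep h𝒳).2 (by rw [hqa]; exact ⟨hd, rfl⟩)⟩⟩

theorem CoreLaws.hasLocalIdentities_univ (L : CoreLaws r m c) :
    HasLocalIdentities r m c Set.univ := fun a =>
  ⟨none, trivial, rfl, fun _ _ _ => ⟨trivial, fun b hb => L.inf_comm a b ▸ hb⟩⟩

theorem hasLocalIdentities_of_dom {d : A → A}
    (T : DomLaws r m c d) : HasLocalIdentities r m c {p | p ≠ none} := fun a =>
  ⟨some (d a), Option.some_ne_none _, T.dom_comp a, fun _ U ha =>
    ⟨U.up ha _ (T.le_dom a), fun b hb => U.up hb _ (T.eq_of_comp a b)⟩⟩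

/-- The antidomain of zero is the identity of the whole base, so one element serves for all `a`. -/
theorem CoreLaws.hasLocalIdentities_of_antidom (L : CoreLaws r m c) {d : A → A}
    (T : AntidomLaws r c d) : HasLocalIdentities r m c {p | p ≠ none} := fun a =>
  ⟨some (d (r a a)), Option.some_ne_none _, T.one_comp a a, fun _ U ha =>
    ⟨U.up ha _ (T.le_one a a), fun b hb => by
      simp only [act, T.one_comp] at hb
      exact L.inf_comm a b ▸ hb⟩⟩

end Germs

/-! ### Concrete representations and soundness of the laws -/

section Semantics

variable {σ : Signature} {A : Type u} [(lang σ).Structure A] {X : Type u}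

/-- A unary operation of a `σ`-algebra. -/
def op₁ (o : Op 1) (h : (⟨1, o⟩ : Σ n, Op n) ∈ σ) (a : A) : A :=
  FirstOrder.Language.Structure.funMap (lang.sym o h) ![a]

/-- Relative complement, as the term `(a ∧ b) ▷ a`. -/
def diff (h_arest : (⟨2, Op.arest⟩ : Σ n, Op n) ∈ σ)
    (h_inter : (⟨2, Op.inter⟩ : Σ n, Op n) ∈ σ) (a b : A) : A :=
  op₂ .arest h_arest (op₂ .inter h_inter a b) a

variable (σ) in
/-- A faithful homomorphism into the partial functions on `X`. -/
structure IsRep (θ : A → SetRel X X) : Prop where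
  inj : Function.Injective θ
  functional : ∀ a, IsPartialFunction (θ a)
  hom : ∀ {n : ℕ} (o : Op n) (h : (⟨n, o⟩ : Σ n, Op n) ∈ σ) (v : Fin n → A),
    θ (FirstOrder.Language.Structure.funMap (lang.sym o h) v) = o.eval fun i => θ (v i)

theorem isRep_of_equiv {F : FunctionAlgebra.{u} σ} (e : A ≃[lang σ] F.carrier) :
    IsRep σ fun a => (e a : SetRel F.base F.base) where
  inj := Subtype.val_injective.comp e.injective
  functional a := F.functional _ (e a).2
  hom o h v := by
    rw [e.map_fun]
    rfl

/-- The algebra of partial functions that is the image of a faithful homomorphism. -/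
def IsRep.range [Nonempty A] {θ : A → SetRel X X} (R : IsRep σ θ)
    (hX : ∀ x, ∃ a, x ∈ (θ a).dom ∨ x ∈ (θ a).cod) : FunctionAlgebra.{u} σ where
  base := X
  carrier := Set.range θ
  nonempty := Set.range_nonempty θ
  functional := by
    rintro _ ⟨a, rfl⟩
    exact R.functional a
  base_eq x := by
    obtain ⟨a, ha⟩ := hX x
    exact ⟨θ a, ⟨a, rfl⟩, ha⟩
  closed n o h v hv := by
    choose w hw using hv
    exact ⟨_, (R.hom o h w).trans (congrArg o.eval (funext hw))⟩

/-- The isomorphism onto its image given by a faithful homomorphism. -/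
noncomputable def IsRep.equivRange [Nonempty A] {θ : A → SetRel X X} (R : IsRep σ θ)
    (hX : ∀ x, ∃ a, x ∈ (θ a).dom ∨ x ∈ (θ a).cod) : A ≃[lang σ] (R.range hX).carrier where
  toEquiv := Equiv.ofInjective θ R.inj
  map_fun' f v := Subtype.ext (R.hom f.1 f.2 v)
  map_rel' r := nomatch r

variable {θ : A → SetRel X X}

theorem IsRep.mem_arest (R : IsRep σ θ) (h : (⟨2, Op.arest⟩ : Σ n, Op n) ∈ σ)
    (a b : A) (x y : X) :
    (x, y) ∈ θ (op₂ .arest h a b) ↔ (∀ z, (x, z) ∉ θ a) ∧ (x, y) ∈ θ b := by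
  rw [op₂, R.hom]
  simp [Op.eval, arestRel]

theorem IsRep.mem_inter (R : IsRep σ θ) (h : (⟨2, Op.inter⟩ : Σ n, Op n) ∈ σ)
    (a b : A) (x y : X) :
    (x, y) ∈ θ (op₂ .inter h a b) ↔ (x, y) ∈ θ a ∧ (x, y) ∈ θ b := by
  rw [op₂, R.hom]
  simp [Op.eval]

theorem IsRep.mem_compo (R : IsRep σ θ) (h : (⟨2, Op.compo⟩ : Σ n, Op n) ∈ σ)
    (a b : A) (x y : X) :
    (x, y) ∈ θ (op₂ .compo h a b) ↔ ∃ z, (x, z) ∈ θ a ∧ (z, y) ∈ θ b := by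
  rw [op₂, R.hom]
  simp [Op.eval, compRel]

theorem IsRep.mem_update (R : IsRep σ θ) (h : (⟨2, Op.update⟩ : Σ n, Op n) ∈ σ)
    (a b : A) (x y : X) :
    (x, y) ∈ θ (op₂ .update h a b) ↔
      ((x, y) ∈ θ a ∧ ∀ z, (x, z) ∉ θ b) ∨ (∃ z, (x, z) ∈ θ a) ∧ (x, y) ∈ θ b := by
  rw [op₂, R.hom]
  simp [Op.eval, updateRel]

theorem IsRep.mem_pref (R : IsRep σ θ) (h : (⟨2, Op.pref⟩ : Σ n, Op n) ∈ σ)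
    (a b : A) (x y : X) :
    (x, y) ∈ θ (op₂ .pref h a b) ↔
      (x, y) ∈ θ a ∨ (∀ z, (x, z) ∉ θ a) ∧ (x, y) ∈ θ b := by
  rw [op₂, R.hom]
  simp [Op.eval, prefRel]

theorem IsRep.mem_dom (R : IsRep σ θ) (h : (⟨1, Op.dom⟩ : Σ n, Op n) ∈ σ)
    (a : A) (x y : X) :
    (x, y) ∈ θ (op₁ .dom h a) ↔ x = y ∧ ∃ z, (x, z) ∈ θ a := by
  rw [op₁, R.hom]
  simp [Op.eval, domRel]

theorem IsRep.mem_antidom (R : IsRep σ θ) (h : (⟨1, Op.antidom⟩ : Σ n, Op n) ∈ σ)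
    (a : A) (x y : X) :
    (x, y) ∈ θ (op₁ .antidom h a) ↔ x = y ∧ ∀ z, (x, z) ∉ θ a := by
  rw [op₁, R.hom]
  simp [Op.eval, antidomRel]

theorem IsRep.ext (R : IsRep σ θ) {a b : A} (h : ∀ x y, (x, y) ∈ θ a ↔ (x, y) ∈ θ b) : a = b :=
  R.inj (Set.ext fun ⟨x, y⟩ => h x y)

variable (h_arest : (⟨2, Op.arest⟩ : Σ n, Op n) ∈ σ) (h_inter : (⟨2, Op.inter⟩ : Σ n, Op n) ∈ σ)
  (h_compo : (⟨2, Op.compo⟩ : Σ n, Op n) ∈ σ)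

theorem IsRep.coreLaws (R : IsRep σ θ) :
    CoreLaws (A := A) (op₂ .arest h_arest) (op₂ .inter h_inter) (op₂ .compo h_compo) := by
  have F : ∀ a x y z, (x, y) ∈ θ a → (x, z) ∈ θ a → y = z := R.functional
  constructor <;> intros <;> refine R.ext fun u v => ?_ <;>
    simp only [R.mem_arest, R.mem_inter, R.mem_compo] <;> grind

theorem IsRep.updateLaws (R : IsRep σ θ) (h : (⟨2, Op.update⟩ : Σ n, Op n) ∈ σ) :
    UpdateLaws (A := A) (op₂ .arest h_arest) (op₂ .inter h_inter) (op₂ .compo h_compo)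
      (op₂ .update h) := by
  have F : ∀ a x y z, (x, y) ∈ θ a → (x, z) ∈ θ a → y = z := R.functional
  constructor <;> intros <;> refine R.ext fun u v => ?_ <;>
    simp only [R.mem_arest, R.mem_inter, R.mem_compo, R.mem_update] <;> grind

theorem IsRep.prefLaws (R : IsRep σ θ) (h : (⟨2, Op.pref⟩ : Σ n, Op n) ∈ σ) :
    PrefLaws (A := A) (op₂ .arest h_arest) (op₂ .inter h_inter) (op₂ .compo h_compo)
      (op₂ .pref h) := by
  have F : ∀ a x y z, (x, y) ∈ θ a → (x, z) ∈ θ a → y = z := R.functional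
  constructor <;> intros <;> refine R.ext fun u v => ?_ <;>
    simp only [R.mem_arest, R.mem_inter, R.mem_compo, R.mem_pref] <;> grind

theorem IsRep.domLaws (R : IsRep σ θ) (h : (⟨1, Op.dom⟩ : Σ n, Op n) ∈ σ) :
    DomLaws (A := A) (op₂ .arest h_arest) (op₂ .inter h_inter) (op₂ .compo h_compo)
      (op₁ .dom h) := by
  have F : ∀ a x y z, (x, y) ∈ θ a → (x, z) ∈ θ a → y = z := R.functional
  constructor <;> intros <;> refine R.ext fun u v => ?_ <;>
    simp only [R.mem_arest, R.mem_inter, R.mem_compo, R.mem_dom] <;> grind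

theorem IsRep.antidomLaws (R : IsRep σ θ) (h : (⟨1, Op.antidom⟩ : Σ n, Op n) ∈ σ) :
    AntidomLaws (A := A) (op₂ .arest h_arest) (op₂ .compo h_compo) (op₁ .antidom h) := by
  have F : ∀ a x y z, (x, y) ∈ θ a → (x, z) ∈ θ a → y = z := R.functional
  constructor <;> intros <;> refine R.ext fun u v => ?_ <;>
    simp only [R.mem_arest, R.mem_compo, R.mem_antidom] <;> grind

theorem IsRep.le_iff (R : IsRep σ θ) {a b : A} : Le h_arest a b ↔ θ a ⊆ θ b := by
  have F : ∀ a x y z, (x, y) ∈ θ a → (x, z) ∈ θ a → y = z := R.functional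
  have hmem : ∀ x y, (x, y) ∈ θ (rest h_arest a b) ↔ (∃ z, (x, z) ∈ θ a) ∧ (x, y) ∈ θ b := by
    intro x y
    simp only [rest, R.mem_arest]
    grind
  constructor
  · rintro h ⟨x, y⟩ hxy
    rw [← show rest h_arest a b = a from h, hmem] at hxy
    exact hxy.2
  · intro h
    refine R.ext fun x y => ?_
    rw [hmem]
    exact ⟨fun ⟨⟨z, hz⟩, hy⟩ => F b x z y (h hz) hy ▸ hz, fun hy => ⟨⟨y, hy⟩, h hy⟩⟩

theorem IsRep.isZero_iff (R : IsRep σ θ) {a : A} : IsZero h_arest a ↔ θ a = ∅ := by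
  constructor
  · intro h
    ext ⟨x, y⟩
    rw [← show op₂ .arest h_arest a a = a from h, R.mem_arest]
    simp only [Set.mem_empty_iff_false, iff_false]
    exact fun h' => h'.1 y h'.2
  · intro h
    refine R.ext fun x y => ?_
    rw [R.mem_arest, h]
    simp

/-- By single-valuedness, a point of the domain of `a` lies outside that of `a ∧ b` exactly when `b`
does not share the value of `a` there. -/
theorem IsRep.map_diff (R : IsRep σ θ) (a b : A) : θ (diff h_arest h_inter a b) = θ a \ θ b := by
  have F : ∀ a x y z, (x, y) ∈ θ a → (x, z) ∈ θ a → y = z := R.functional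
  ext ⟨x, y⟩
  simp only [diff, R.mem_arest, R.mem_inter, Set.mem_sdiff]
  grind

theorem IsRep.isAtomElt_iff (R : IsRep σ θ) {a : A} : IsAtomElt h_arest a ↔
    θ a ≠ ∅ ∧ ∀ b, θ b ≠ ∅ → θ b ⊆ θ a → θ b = θ a := by
  simp only [IsAtomElt, R.isZero_iff h_arest, R.le_iff h_arest, R.inj.eq_iff]

theorem IsRep.isJoin_iff (R : IsRep σ θ) {S : Set A} {j : A} : IsJoin h_arest S j ↔
    (∀ s ∈ S, θ s ⊆ θ j) ∧ ∀ b, (∀ s ∈ S, θ s ⊆ θ b) → θ j ⊆ θ b := by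
  simp only [IsJoin, R.le_iff h_arest]

theorem IsRep.isMeet_iff (R : IsRep σ θ) {S : Set A} {j : A} : IsMeet h_arest S j ↔
    (∀ s ∈ S, θ j ⊆ θ s) ∧ ∀ b, (∀ s ∈ S, θ b ⊆ θ s) → θ b ⊆ θ j := by
  simp only [IsMeet, R.le_iff h_arest]

/-! ### Complete representations, atoms and distributivity -/

/-- A join-complete faithful homomorphism is meet complete. -/
theorem IsRep.meetComplete (R : IsRep σ θ)
    (h_inter : (⟨2, Op.inter⟩ : Σ n, Op n) ∈ σ)
    (H : ∀ (S : Set A) (j : A), IsJoin h_arest S j → θ j = ⋃ s ∈ S, θ s)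
    {S : Set A} {k : A} (hS : S.Nonempty) (hk : IsMeet h_arest S k) : θ k = ⋂ s ∈ S, θ s := by
  rw [R.isMeet_iff] at hk
  refine Set.Subset.antisymm (Set.subset_iInter₂ hk.1) fun p hp => ?_
  rw [Set.mem_iInter₂] at hp
  by_contra hpk
  obtain ⟨s₀, hs₀⟩ := hS
  -- Complementing inside a fixed `s₀ ∈ S` turns the meet into a join. If `b` bounds all `s₀ \ s`,
  -- then `(s₀ \ k) \ b` lies below every `s`, hence below `k`, and so is empty.
  have hj : IsJoin h_arest (diff h_arest h_inter s₀ '' S) (diff h_arest h_inter s₀ k) := by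
    rw [R.isJoin_iff]
    simp only [Set.forall_mem_image, R.map_diff]
    refine ⟨fun s hs => Set.sdiff_subset_sdiff_right (hk.1 s hs), fun b hb q hq => ?_⟩
    by_contra hqb
    have := hk.2 (diff h_arest h_inter (diff h_arest h_inter s₀ k) b) fun s hs q hq => by
      simp only [R.map_diff] at hq
      by_contra hqs
      exact hq.2 (hb hs ⟨hq.1.1, hqs⟩)
    simp only [R.map_diff] at this
    exact hq.2 (this ⟨hq, hqb⟩)
  have hp' : p ∈ θ (diff h_arest h_inter s₀ k) := by
    rw [R.map_diff]
    exact ⟨hp _ hs₀, hpk⟩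
  rw [H _ _ hj, Set.mem_iUnion₂] at hp'
  obtain ⟨_, ⟨s, hs, rfl⟩, hps⟩ := hp'
  rw [R.map_diff] at hps
  exact hps.2 (hp s hs)

/-- A meet-complete faithful homomorphism is join complete. -/
theorem IsRep.joinComplete (R : IsRep σ θ)
    (h_inter : (⟨2, Op.inter⟩ : Σ n, Op n) ∈ σ)
    (H : ∀ (S : Set A) (k : A), S.Nonempty → IsMeet h_arest S k → θ k = ⋂ s ∈ S, θ s)
    {S : Set A} {j : A} (hj : IsJoin h_arest S j) : θ j = ⋃ s ∈ S, θ s := by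
  rw [R.isJoin_iff] at hj
  refine Set.Subset.antisymm (fun p hp => ?_) (Set.iUnion₂_subset hj.1)
  by_contra hpS
  simp only [Set.mem_iUnion₂, not_exists] at hpS
  have hzero : θ (diff h_arest h_inter j j) = ∅ := by rw [R.map_diff, sdiff_self]; rfl
  -- The hypothesis says nothing about empty meets, so the empty join is treated separately: it lies
  -- below zero.
  rcases S.eq_empty_or_nonempty with rfl | hS
  · have := hj.2 (diff h_arest h_inter j j) (by simp) hp
    rw [hzero] at this
    exact this
  -- The complements `j \ s` have meet zero: a `b` below all of them is disjoint from every `s`, so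
  -- `j ≤ j \ b`.
  · have hk : IsMeet h_arest (diff h_arest h_inter j '' S) (diff h_arest h_inter j j) := by
      rw [R.isMeet_iff]
      simp only [Set.forall_mem_image, R.map_diff]
      refine ⟨fun s hs => Set.sdiff_subset_sdiff_right (hj.1 s hs), fun b hb q hq => ?_⟩
      obtain ⟨s₀, hs₀⟩ := hS
      have := hj.2 (diff h_arest h_inter j b) fun s hs q hq => by
        rw [R.map_diff]
        exact ⟨hj.1 s hs hq, fun hqb => (hb hs hqb).2 hq⟩
      rw [R.map_diff] at this
      exact absurd hq (this (hb hs₀ hq).1).2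
    have := H _ _ (hS.image _) hk
    have hp' : p ∈ ⋂ s ∈ diff h_arest h_inter j '' S, θ s := by
      simp only [Set.mem_iInter₂, Set.forall_mem_image, R.map_diff]
      exact fun s hs => ⟨hp, hpS s hs⟩
    rw [← this, hzero] at hp'
    exact hp'

/-- With separating atoms, every element is the join of the atoms below it. -/
theorem isJoin_atoms (hsep : AtomsSeparating A h_arest) (b : A) :
    IsJoin h_arest {x | IsAtomElt h_arest x ∧ Le h_arest x b} b := by
  refine ⟨fun x hx => hx.2, fun u hu => ?_⟩
  by_contra hbu
  obtain ⟨x, hx, hxb, hxu⟩ := hsep b u hbu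
  exact hxu (hu x ⟨hx, hxb⟩)

/-- Around a pair `p` in `θ a` but not in `θ b` an atom is cut out: join completeness prevents `d =
a \ b` from being the join of the elements below it that miss `p`. Some upper bound `w` of these is
not above `d`, and `d \ w` is the atom. -/
theorem IsRep.atomsSeparating (R : IsRep σ θ)
    (h_inter : (⟨2, Op.inter⟩ : Σ n, Op n) ∈ σ)
    (H : ∀ (S : Set A) (j : A), IsJoin h_arest S j → θ j = ⋃ s ∈ S, θ s) :
    AtomsSeparating A h_arest := by
  intro a b hab
  rw [R.le_iff, Set.not_subset] at hab
  obtain ⟨p, hpa, hpb⟩ := hab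
  have hpd : p ∈ θ (diff h_arest h_inter a b) := by
    rw [R.map_diff]
    exact ⟨hpa, hpb⟩
  set d := diff h_arest h_inter a b with hd
  have hnot : ¬ IsJoin h_arest {s | θ s ⊆ θ d ∧ p ∉ θ s} d := by
    intro hj
    have h := hpd
    rw [H _ _ hj, Set.mem_iUnion₂] at h
    obtain ⟨s, hs, hps⟩ := h
    exact hs.2 hps
  rw [R.isJoin_iff, not_and] at hnot
  have hnot' := hnot fun s hs => hs.1
  push Not at hnot'
  obtain ⟨w, hw, hdw⟩ := hnot'
  have hc : θ (diff h_arest h_inter d w) = θ d \ θ w := R.map_diff h_arest h_inter d w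
  -- A nonempty `y` below `d \ w` that missed `p` would also lie below `w`.
  have hcp : ∀ y, θ y ≠ ∅ → θ y ⊆ θ d \ θ w → p ∈ θ y := by
    intro y hy hyc
    by_contra hpy
    have := hw y ⟨hyc.trans Set.sdiff_subset, hpy⟩
    exact hy (Set.eq_empty_of_forall_notMem fun q hq => (hyc hq).2 (this hq))
  have hne : θ (diff h_arest h_inter d w) ≠ ∅ := by
    rw [hc]
    exact fun h => hdw (Set.sdiff_eq_empty.1 h)
  refine ⟨diff h_arest h_inter d w, ?_, ?_, ?_⟩
  · rw [R.isAtomElt_iff]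
    refine ⟨hne, fun y hy hyc => hyc.antisymm fun q hq => ?_⟩
    rw [hc] at hyc hq
    by_contra hqy
    have hpy := hcp y hy hyc
    -- A proper nonzero part `y` and its complement in `d \ w` would both contain `p`.
    have := hcp (diff h_arest h_inter (diff h_arest h_inter d w) y)
      (by rw [R.map_diff, hc]; exact Set.Nonempty.ne_empty ⟨q, hq, hqy⟩)
      (by rw [R.map_diff, hc]; exact Set.sdiff_subset)
    rw [R.map_diff] at this
    exact this.2 hpy
  · rw [R.le_iff, hc]
    refine Set.sdiff_subset.trans ?_
    rw [hd, R.map_diff]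
    exact Set.sdiff_subset
  · rw [R.le_iff]
    intro hb
    obtain ⟨q, hq⟩ := Set.nonempty_iff_ne_empty.2 hne
    have h₁ := hb hq
    rw [hc, hd, R.map_diff] at hq
    exact hq.1.2 h₁

theorem IsRep.compLeftDistribAtoms (R : IsRep σ θ)
    (H : ∀ (S : Set A) (j : A), IsJoin h_arest S j → θ j = ⋃ s ∈ S, θ s)
    (hsep : AtomsSeparating A h_arest) : CompLeftDistribAtoms A h_arest h_compo := by
  intro a b c h
  rw [R.le_iff]
  rintro ⟨x, y⟩ hxy
  rw [R.mem_compo] at hxy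
  obtain ⟨z, hxz, hzy⟩ := hxy
  rw [H _ _ (isJoin_atoms h_arest hsep b), Set.mem_iUnion₂] at hzy
  obtain ⟨t, ⟨ht, htb⟩, hzy⟩ := hzy
  exact (R.le_iff h_arest).1 (h t ht htb) ((R.mem_compo h_compo a t x y).2 ⟨z, hxz, hzy⟩)

theorem IsRep.comp_mono (R : IsRep σ θ) {a b b' : A} (h : Le h_arest b b') :
    Le h_arest (op₂ .compo h_compo a b) (op₂ .compo h_compo a b') := by
  rw [R.le_iff] at h ⊢
  rintro ⟨x, y⟩ hxy
  rw [R.mem_compo] at hxy ⊢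
  obtain ⟨z, hz, hz'⟩ := hxy
  exact ⟨z, hz, h hz'⟩

/-- Each element is the join of the atoms below it, which gives one direction. For the other, an
atom below a join lies below some member of the set. -/
theorem IsRep.compLeftDistribAtoms_iff (R : IsRep σ θ)
    (h_inter : (⟨2, Op.inter⟩ : Σ n, Op n) ∈ σ) (hsep : AtomsSeparating A h_arest) :
    CompLeftDistribAtoms A h_arest h_compo ↔ CompLeftDistribJoins A h_arest h_compo := by
  constructor
  · intro H S j a hj
    refine ⟨?_, fun c hc => H a j c fun x hx hxj => ?_⟩
    · rintro _ ⟨s, hs, rfl⟩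
      exact R.comp_mono h_arest h_compo (hj.1 s hs)
    · have : ∃ s ∈ S, Le h_arest x s := by
        by_contra! hno
        -- An atom `x` below no `s ∈ S` is disjoint from all of them, so `j \ x` bounds `S`. Then `j
        -- ≤ j \ x`, against `x ≤ j`.
        have hjx := hj.2 (diff h_arest h_inter j x) fun s hs => by
          rw [R.le_iff, R.map_diff]
          rintro q hq
          refine ⟨(R.le_iff h_arest).1 (hj.1 s hs) hq, fun hqx => hno s hs ?_⟩
          rw [R.isAtomElt_iff] at hx
          have := hx.2 (op₂ .inter h_inter x s)
            (Set.Nonempty.ne_empty ⟨q, (R.mem_inter h_inter x s q.1 q.2).2 ⟨hqx, hq⟩⟩)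
            (fun q hq => ((R.mem_inter h_inter x s q.1 q.2).1 hq).1)
          rw [R.le_iff]
          intro q hq
          rw [← this] at hq
          exact ((R.mem_inter h_inter x s q.1 q.2).1 hq).2
        rw [R.le_iff, R.map_diff] at hjx
        rw [R.isAtomElt_iff] at hx
        obtain ⟨q, hq⟩ := Set.nonempty_iff_ne_empty.2 hx.1
        exact (hjx ((R.le_iff h_arest).1 hxj hq)).2 hq
      obtain ⟨s, hs, hxs⟩ := this
      have h₁ := R.comp_mono h_arest h_compo (a := a) hxs
      have h₂ := hc _ (Set.mem_image_of_mem _ hs)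
      rw [R.le_iff] at h₁ h₂ ⊢
      exact h₁.trans h₂
  · intro H a b c h
    refine (H _ _ a (isJoin_atoms h_arest hsep b)).2 c ?_
    rintro _ ⟨x, hx, rfl⟩
    exact h x hx.1 hx.2

end Semantics

/-! ### Representation theorem for the full signature -/

section Representation

variable {σ : Signature} {A : Type u}

variable (σ A) in
/-- The elements used as points: all those of the algebra, and an additional identity unless the
signature contains an operation whose values are subidentities. -/
def pointSet : Set (Option A) :=
  {p | ((⟨1, Op.dom⟩ : Σ n, Op n) ∈ σ ∨ (⟨1, Op.antidom⟩ : Σ n, Op n) ∈ σ) → p ≠ none}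

theorem some_mem_pointSet (a : A) : some a ∈ pointSet σ A := fun _ => Option.some_ne_none a

variable [(lang σ).Structure A]

variable (A) in
/-- The equations that define the representable `σ`-algebras. -/
structure SatisfiesLaws (h_arest : (⟨2, Op.arest⟩ : Σ n, Op n) ∈ σ)
    (h_inter : (⟨2, Op.inter⟩ : Σ n, Op n) ∈ σ) (h_compo : (⟨2, Op.compo⟩ : Σ n, Op n) ∈ σ) :
    Prop where
  core : CoreLaws (A := A) (op₂ .arest h_arest) (op₂ .inter h_inter) (op₂ .compo h_compo)
  update : ∀ h : (⟨2, Op.update⟩ : Σ n, Op n) ∈ σ,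
    UpdateLaws (A := A) (op₂ .arest h_arest) (op₂ .inter h_inter)
      (op₂ .compo h_compo) (op₂ .update h)
  pref : ∀ h : (⟨2, Op.pref⟩ : Σ n, Op n) ∈ σ,
    PrefLaws (A := A) (op₂ .arest h_arest) (op₂ .inter h_inter)
      (op₂ .compo h_compo) (op₂ .pref h)
  dom : ∀ h : (⟨1, Op.dom⟩ : Σ n, Op n) ∈ σ,
    DomLaws (A := A) (op₂ .arest h_arest) (op₂ .inter h_inter)
      (op₂ .compo h_compo) (op₁ .dom h)
  antidom : ∀ h : (⟨1, Op.antidom⟩ : Σ n, Op n) ∈ σ,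
    AntidomLaws (A := A) (op₂ .arest h_arest) (op₂ .compo h_compo) (op₁ .antidom h)

variable {h_arest : (⟨2, Op.arest⟩ : Σ n, Op n) ∈ σ} {h_inter : (⟨2, Op.inter⟩ : Σ n, Op n) ∈ σ}
  {h_compo : (⟨2, Op.compo⟩ : Σ n, Op n) ∈ σ}

theorem IsRep.satisfiesLaws {X : Type u} {θ : A → SetRel X X} (R : IsRep σ θ) :
    SatisfiesLaws A h_arest h_inter h_compo :=
  ⟨R.coreLaws h_arest h_inter h_compo, R.updateLaws h_arest h_inter h_compo,
    R.prefLaws h_arest h_inter h_compo, R.domLaws h_arest h_inter h_compo,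
    R.antidomLaws h_arest h_compo⟩

theorem SatisfiesLaws.hasLocalIdentities (L : SatisfiesLaws A h_arest h_inter h_compo) :
    HasLocalIdentities (op₂ .arest h_arest) (op₂ .inter h_inter) (op₂ .compo h_compo)
      (pointSet σ A) := by
  by_cases h : (⟨1, Op.dom⟩ : Σ n, Op n) ∈ σ ∨ (⟨1, Op.antidom⟩ : Σ n, Op n) ∈ σ
  · have hP : pointSet σ A = {p | p ≠ none} := Set.ext fun p => ⟨fun hp => hp h, fun hp _ => hp⟩
    rw [hP]
    rcases h with h | h
    · exact hasLocalIdentities_of_dom (L.dom h)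
    · exact L.core.hasLocalIdentities_of_antidom (L.antidom h)
  · have hP : pointSet σ A = Set.univ := Set.eq_univ_of_forall fun p hp => absurd hp h
    rw [hP]
    exact L.core.hasLocalIdentities_univ

theorem funMap_eq_op₂ (o : Op 2) (h : (⟨2, o⟩ : Σ n, Op n) ∈ σ) (v : Fin 2 → A) :
    FirstOrder.Language.Structure.funMap (lang.sym o h) v = op₂ o h (v 0) (v 1) :=
  congrArg _ (funext fun i => by fin_cases i <;> rfl)

theorem funMap_eq_op₁ (o : Op 1) (h : (⟨1, o⟩ : Σ n, Op n) ∈ σ) (v : Fin 1 → A) :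
    FirstOrder.Language.Structure.funMap (lang.sym o h) v = op₁ o h (v 0) :=
  congrArg _ (funext fun i => by fin_cases i; rfl)

theorem SatisfiesLaws.isRep_germRep (L : SatisfiesLaws A h_arest h_inter h_compo)
    {𝒳 : Set (Set A)} (h𝒳 : ∀ x ∈ 𝒳, IsUltra (op₂ .arest h_arest) x)
    (hsep : ∀ a : A, op₂ .arest h_arest a a ≠ a → ∃ x ∈ 𝒳, a ∈ x) :
    IsRep σ (germRep (op₂ .inter h_inter) (op₂ .compo h_compo) 𝒳 (pointSet σ A)) where
  inj := L.core.injective_germRep h𝒳 some_mem_pointSet L.hasLocalIdentities hsep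
  functional := L.core.isPartialFunction_germRep h𝒳
  hom o h v := by
    cases o with
    | arest =>
      rw [funMap_eq_op₂]
      exact L.core.germRep_arest h𝒳 some_mem_pointSet _ _
    | compo =>
      rw [funMap_eq_op₂]
      exact L.core.germRep_comp h𝒳 some_mem_pointSet _ _
    | inter =>
      rw [funMap_eq_op₂]
      exact L.core.germRep_inf h𝒳 _ _
    | update =>
      rw [funMap_eq_op₂]
      exact L.core.germRep_update (L.update h) h𝒳 some_mem_pointSet _ _
    | pref =>
      rw [funMap_eq_op₂]
      exact L.core.germRep_pref (L.pref h) h𝒳 some_mem_pointSet _ _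
    | dom =>
      rw [funMap_eq_op₁]
      exact L.core.germRep_dom (L.dom h) h𝒳 some_mem_pointSet (fun hn => hn (Or.inl h) rfl) _
    | antidom =>
      rw [funMap_eq_op₁]
      exact L.core.germRep_antidom (L.antidom h) h𝒳 some_mem_pointSet
        (fun hn => hn (Or.inr h) rfl) _

theorem SatisfiesLaws.exists_isRep (L : SatisfiesLaws A h_arest h_inter h_compo) :
    ∃ (X : Type u) (θ : A → SetRel X X), IsRep σ θ ∧ ∀ x, ∃ a, x ∈ (θ a).dom ∨ x ∈ (θ a).cod := by
  have h𝒳 : ∀ x ∈ {x | IsUltra (op₂ .arest h_arest) x}, IsUltra (A := A) (op₂ .arest h_arest) x :=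
    fun x hx => hx
  exact ⟨_, _, L.isRep_germRep h𝒳 fun a ha => L.core.exists_ultra ha,
    L.core.germBase_covered h𝒳 some_mem_pointSet L.hasLocalIdentities⟩

theorem satisfiesLaws_iff_representable [Nonempty A] :
    SatisfiesLaws A h_arest h_inter h_compo ↔ Representable σ A := by
  constructor
  · intro L
    obtain ⟨X, θ, R, hX⟩ := L.exists_isRep
    exact ⟨R.range hX, ⟨R.equivRange hX⟩⟩
  · rintro ⟨F, ⟨e⟩⟩
    exact (isRep_of_equiv e).satisfiesLaws

/-! ### Ultrafilters at atoms and complete representability -/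

variable (h_arest) in
/-- The elements whose domain contains that of `t`. -/
def domAbove (t : A) : Set A := {a | op₂ .arest h_arest a t = op₂ .arest h_arest t t}

theorem IsRep.mem_domAbove {X : Type u} {θ : A → SetRel X X} (R : IsRep σ θ) {a t : A} :
    a ∈ domAbove h_arest t ↔ ∀ u v, (u, v) ∈ θ t → ∃ w, (u, w) ∈ θ a := by
  constructor
  · intro h u v hv
    by_contra! hno
    have := (R.mem_arest h_arest a t u v).2 ⟨hno, hv⟩
    rw [show op₂ .arest h_arest a t = _ from h, R.mem_arest] at this
    exact this.1 v hv
  · intro h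
    refine R.ext fun u v => ?_
    rw [R.mem_arest, R.mem_arest]
    exact ⟨fun ⟨h₁, h₂⟩ => absurd (h u v h₂) (not_exists.2 h₁), fun ⟨h₁, h₂⟩ => absurd h₂ (h₁ v)⟩

/-- The domain of an element is disjoint from that of an atom unless it contains it. -/
theorem IsRep.notMem_domAbove {X : Type u} {θ : A → SetRel X X} (R : IsRep σ θ) {a t : A}
    (ht : IsAtomElt h_arest t) :
    a ∉ domAbove h_arest t ↔ ∀ u v w, (u, v) ∈ θ t → (u, w) ∉ θ a := by
  rw [R.isAtomElt_iff] at ht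
  constructor
  · intro h u v w huv huw
    have hne : θ (op₂ .arest h_arest a t) ≠ ∅ := by
      intro h0
      refine h (R.mem_domAbove.2 fun u v huv => ?_)
      by_contra! hno
      have := (R.mem_arest h_arest a t u v).2 ⟨hno, huv⟩
      rw [h0] at this
      exact this
    rw [← ht.2 _ hne fun p hp => ((R.mem_arest h_arest a t p.1 p.2).1 hp).2, R.mem_arest] at huv
    exact huv.1 w huw
  · intro h h'
    obtain ⟨⟨u, v⟩, huv⟩ := Set.nonempty_iff_ne_empty.2 ht.1
    obtain ⟨w, hw⟩ := R.mem_domAbove.1 h' u v huv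
    exact h u v w huv hw

/-- Every domain either contains that of the atom `t` or is disjoint from it; this dichotomy yields
primeness. -/
theorem IsRep.isUltra_domAbove {X : Type u} {θ : A → SetRel X X} (R : IsRep σ θ) {t : A}
    (ht : IsAtomElt h_arest t) : IsUltra (op₂ .arest h_arest) (domAbove h_arest t) where
  nonempty := ⟨t, rfl⟩
  zero a := by
    rw [R.notMem_domAbove ht]
    intro u v w _ hw
    rw [R.mem_arest] at hw
    exact hw.1 w hw.2
  up {a b} ha e he := by
    rw [R.mem_domAbove] at ha ⊢
    intro u v huv
    obtain ⟨w, hw⟩ := ha u v huv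
    by_contra! hno
    have := (R.mem_arest h_arest b a u w).2 ⟨hno, hw⟩
    rw [he, R.mem_arest] at this
    exact this.1 w this.2
  inter {a b} ha hb := by
    rw [R.mem_domAbove] at ha hb ⊢
    intro u v huv
    obtain ⟨w, hw⟩ := ha u v huv
    obtain ⟨w', hw'⟩ := hb u v huv
    refine ⟨w', ?_⟩
    rw [R.mem_arest]
    exact ⟨fun z hz => ((R.mem_arest h_arest a b u z).1 hz).1 w hw, hw'⟩
  prime {a b} hb ha := by
    rw [R.notMem_domAbove ht] at ha
    rw [R.mem_domAbove] at hb ⊢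
    intro u v huv
    obtain ⟨w, hw⟩ := hb u v huv
    exact ⟨w, (R.mem_arest h_arest a b u w).2 ⟨fun z => ha u v z huv, hw⟩⟩

theorem CompLeftDistribJoins.isJoin_act (hd : CompLeftDistribJoins A h_arest h_compo)
    {S : Set A} {j : A} (hj : IsJoin h_arest S j)
    (p : Option A) :
    IsJoin h_arest (act (op₂ .compo h_compo) p '' S) (act (op₂ .compo h_compo) p j) := by
  cases p with
  | none =>
    change IsJoin h_arest ((fun b => b) '' S) j
    rwa [Set.image_id']
  | some a => exact hd S j a hj

/-- The germs at the atoms give a join-complete representation. -/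
theorem SatisfiesLaws.exists_joinComplete (L : SatisfiesLaws A h_arest h_inter h_compo)
    (hsep : AtomsSeparating A h_arest) (hd : CompLeftDistribJoins A h_arest h_compo) :
    ∃ (X : Type u) (θ : A → SetRel X X), IsRep σ θ ∧
      (∀ x, ∃ a, x ∈ (θ a).dom ∨ x ∈ (θ a).cod) ∧
      ∀ (S : Set A) (j : A), IsJoin h_arest S j → θ j = ⋃ s ∈ S, θ s := by
  -- Not the representation being built: an arbitrary one, in which consequences of the laws can be
  -- read off pointwise.
  obtain ⟨Y, ρ, Rρ, -⟩ := L.exists_isRep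
  have h𝒳 : ∀ x ∈ domAbove h_arest '' {t : A | IsAtomElt h_arest t},
      IsUltra (op₂ .arest h_arest) x := by
    rintro _ ⟨t, ht, rfl⟩
    exact Rρ.isUltra_domAbove ht
  have hsep' : ∀ a : A, op₂ .arest h_arest a a ≠ a →
      ∃ x ∈ domAbove h_arest '' {t : A | IsAtomElt h_arest t}, a ∈ x := by
    intro a ha
    -- A nonzero `a` is not below zero, so separation yields an atom `t ≤ a`.
    obtain ⟨t, ht, hta, -⟩ := hsep a (op₂ .arest h_arest a a) fun h =>
      ha <| (Rρ.isZero_iff h_arest).2 <| Set.eq_empty_of_forall_notMem fun q hq =>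
        ((Rρ.mem_arest h_arest a a q.1 q.2).1 ((Rρ.le_iff h_arest).1 h hq)).1 q.2 hq
    refine ⟨_, ⟨t, ht, rfl⟩, Rρ.mem_domAbove.2 fun u v huv => ⟨v, ?_⟩⟩
    exact (Rρ.le_iff h_arest).1 hta huv
  have R := L.isRep_germRep h𝒳 hsep'
  refine ⟨_, _, R, L.core.germBase_covered h𝒳 some_mem_pointSet L.hasLocalIdentities,
    fun S j hj => Set.Subset.antisymm ?_ (Set.iUnion₂_subset fun s hs =>
      (R.le_iff h_arest).1 (hj.1 s hs))⟩
  rintro ⟨w, v⟩ hwv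
  obtain ⟨x, hx, p, hp, hpd, rfl⟩ := w.exists_mk
  rw [L.core.mem_germRep h𝒳] at hwv
  obtain ⟨t, ht, rfl⟩ := id hx
  have U := h𝒳 _ hx
  have hpj := hd.isJoin_act hj p
  -- If no `p ∘ s` were defined at `t`, then `t ▷ (p ∘ j)` would bound all `p ∘ s`. By
  -- distributivity it would lie above their join `p ∘ j`, which is defined at `t`.
  have key : ∃ s ∈ S, act (op₂ .compo h_compo) p s ∈ domAbove h_arest t := by
    by_contra! hno
    rw [Rρ.isJoin_iff] at hpj
    have := hpj.2 (op₂ .arest h_arest t (act (op₂ .compo h_compo) p j)) <| by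
      rintro _ ⟨s, hs, rfl⟩ ⟨y, z⟩ hyz
      rw [Rρ.mem_arest]
      exact ⟨fun z' hz' => (Rρ.notMem_domAbove ht).1 (hno s hs) y z' z hz' hyz,
        hpj.1 _ ⟨s, hs, rfl⟩ hyz⟩
    obtain ⟨⟨y, z⟩, hyz⟩ := Set.nonempty_iff_ne_empty.2 ((Rρ.isAtomElt_iff h_arest).1 ht).1
    obtain ⟨z', hz'⟩ := Rρ.mem_domAbove.1 hwv.1 y z hyz
    exact ((Rρ.mem_arest h_arest _ _ y z').1 (this hz')).1 z hyz
  obtain ⟨s, hs, hps⟩ := key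
  rw [Set.mem_iUnion₂]
  refine ⟨s, hs, (L.core.mem_germRep h𝒳).2 ⟨hps, hwv.2.trans ?_⟩⟩
  -- The germs of `p ∘ j` and `p ∘ s` at `t` agree because `p ∘ s ≤ p ∘ j`.
  rw [(L.core.germ_some_eq_iff U hps).2]
  have hle := (Rρ.le_iff h_arest).1 (hpj.1 _ ⟨s, hs, rfl⟩)
  rw [Rρ.mem_domAbove] at hps ⊢
  intro y z hyz
  obtain ⟨z', hz'⟩ := hps y z hyz
  exact ⟨z', (Rρ.mem_inter h_inter _ _ y z').2 ⟨hz', hle hz'⟩⟩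

theorem joinCompletelyRepresentable_iff [Nonempty A]
    (h_inter : (⟨2, Op.inter⟩ : Σ n, Op n) ∈ σ) (h_compo : (⟨2, Op.compo⟩ : Σ n, Op n) ∈ σ) :
    JoinCompletelyRepresentable A h_arest ↔ SatisfiesLaws A h_arest h_inter h_compo ∧
      AtomsSeparating A h_arest ∧ CompLeftDistribAtoms A h_arest h_compo := by
  constructor
  · rintro ⟨F, e, he⟩
    have R := isRep_of_equiv e
    have hsep := R.atomsSeparating h_arest h_inter he
    exact ⟨R.satisfiesLaws, hsep, R.compLeftDistribAtoms h_arest h_compo he hsep⟩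
  · rintro ⟨L, hsep, hd⟩
    obtain ⟨Y, ρ, Rρ, -⟩ := L.exists_isRep
    obtain ⟨X, θ, R, hX, hj⟩ := L.exists_joinComplete hsep
      ((Rρ.compLeftDistribAtoms_iff h_arest h_compo h_inter hsep).1 hd)
    exact ⟨R.range hX, R.equivRange hX, hj⟩

theorem meetCompletelyRepresentable_iff (h_inter : (⟨2, Op.inter⟩ : Σ n, Op n) ∈ σ) :
    MeetCompletelyRepresentable A h_arest ↔ JoinCompletelyRepresentable A h_arest := by
  constructor
  · rintro ⟨F, e, he⟩
    exact ⟨F, e, fun S j => (isRep_of_equiv e).joinComplete h_arest h_inter he⟩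
  · rintro ⟨F, e, he⟩
    exact ⟨F, e, fun S k => (isRep_of_equiv e).meetComplete h_arest h_inter he⟩

end Representation

/-! ### The laws as equations between terms -/

section Equations

/-- The equations for antidomain restriction, intersection and composition as pairs of terms. -/
def coreEquations {T : Type*} (r m c : T → T → T) (x y z : T) : List (T × T) :=
  [(r x x, r y y),
    (r (r x x) y, y),
    (r (r z y) (r (r y x) (r z x)), r x x),
    (r (r x z) (r (r y z) (r (r (r x y) y) z)), r x x),
    (r y (r x y), r x x),
    (r (r x (r x y)) (r x y), r x x),
    (r x (r (r x y) y), r x x),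
    (r (r x y) (r x (r (r y z) z)), r x x),
    (r (r x z) (r x (r (r y z) z)), r x x),
    (m x x, x),
    (m x y, m y x),
    (r x (m x y), r x x),
    (m (m x y) x, m x y),
    (r (r (m x y) x) x, m x y),
    (r (m x z) (r (r (m x y) (m y z)) (m y z)), r x x),
    (m (r x y) y, r x y),
    (c (c x y) z, c x (c y z)),
    (r x (c x y), r x x),
    (c x (r y z), r (c x y) (c x z)),
    (c x (m y z), m (c x y) (c x z)),
    (r (m (c x z) (c y z)) (r (r (m x y) (c x z)) (c x z)), r x x)]

theorem coreLaws_iff {A : Type*} {r m c : A → A → A} :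
    CoreLaws r m c ↔ ∀ x y z, ∀ e ∈ coreEquations r m c x y z, e.1 = e.2 := by
  simp only [coreEquations, List.forall_mem_cons]
  refine ⟨fun L x y z => ⟨L.self x y, L.self_left x y, L.trans x y z, L.inter x y z, L.right x y,
    L.disjoint x y, L.rest_left x y, L.mono_left x y z, L.mono_right x y z, L.inf_self x,
    L.inf_comm x y, L.inf_dom x y, L.inf_inf x y, L.inf_rest x y, L.inf_trans x y z,
    L.arest_inf x y, L.assoc x y z, L.comp_dom x y, L.comp_arest x y z, L.comp_inf x y z,
    L.inf_comp x y z, by simp⟩, fun h => ⟨fun x y => (h x y x).1,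
    fun x y => (h x y x).2.1,
    fun x y z => (h x y z).2.2.1,
    fun x y z => (h x y z).2.2.2.1,
    fun x y => (h x y x).2.2.2.2.1,
    fun x y => (h x y x).2.2.2.2.2.1,
    fun x y => (h x y x).2.2.2.2.2.2.1,
    fun x y z => (h x y z).2.2.2.2.2.2.2.1,
    fun x y z => (h x y z).2.2.2.2.2.2.2.2.1,
    fun x => (h x x x).2.2.2.2.2.2.2.2.2.1,
    fun x y => (h x y x).2.2.2.2.2.2.2.2.2.2.1,
    fun x y => (h x y x).2.2.2.2.2.2.2.2.2.2.2.1,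
    fun x y => (h x y x).2.2.2.2.2.2.2.2.2.2.2.2.1,
    fun x y => (h x y x).2.2.2.2.2.2.2.2.2.2.2.2.2.1,
    fun x y z => (h x y z).2.2.2.2.2.2.2.2.2.2.2.2.2.2.1,
    fun x y => (h x y x).2.2.2.2.2.2.2.2.2.2.2.2.2.2.2.1,
    fun x y z => (h x y z).2.2.2.2.2.2.2.2.2.2.2.2.2.2.2.2.1,
    fun x y => (h x y x).2.2.2.2.2.2.2.2.2.2.2.2.2.2.2.2.2.1,
    fun x y z => (h x y z).2.2.2.2.2.2.2.2.2.2.2.2.2.2.2.2.2.2.1,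
    fun x y z => (h x y z).2.2.2.2.2.2.2.2.2.2.2.2.2.2.2.2.2.2.2.1,
    fun x y z => (h x y z).2.2.2.2.2.2.2.2.2.2.2.2.2.2.2.2.2.2.2.2.1⟩⟩

/-- The equations for update as pairs of terms. -/
def updateEquations {T : Type*} (r m c t : T → T → T) (x y z : T) : List (T × T) :=
  [(c x (t y z), t (c x y) (c x z)),
    (r x (t x y), r x x),
    (r (t x y) x, r x x),
    (r (m (t x y) y) (r (r x y) y), r x x),
    (r (m (t x y) x) (r y x), r x x)]

theorem updateLaws_iff {A : Type*} {r m c t : A → A → A} :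
    UpdateLaws r m c t ↔ ∀ x y z, ∀ e ∈ updateEquations r m c t x y z, e.1 = e.2 := by
  simp only [updateEquations, List.forall_mem_cons]
  refine ⟨fun L x y z => ⟨L.comp x y z, L.dom_le x y, L.le_dom x y, L.eq_right x y, L.eq_left x y,
    by simp⟩, fun h => ⟨fun x y z => (h x y z).1,
    fun x y => (h x y x).2.1,
    fun x y => (h x y x).2.2.1,
    fun x y => (h x y x).2.2.2.1,
    fun x y => (h x y x).2.2.2.2.1⟩⟩

/-- The equations for preferential union as pairs of terms. -/
def prefEquations {T : Type*} (r m c t : T → T → T) (x y z : T) : List (T × T) :=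
  [(c x (t y z), t (c x y) (c x z)),
    (r (m (t x y) x) x, r x x),
    (r (m (t x y) y) (r x y), r x x),
    (r y (r x (t x y)), r x x)]

theorem prefLaws_iff {A : Type*} {r m c t : A → A → A} :
    PrefLaws r m c t ↔ ∀ x y z, ∀ e ∈ prefEquations r m c t x y z, e.1 = e.2 := by
  simp only [prefEquations, List.forall_mem_cons]
  refine ⟨fun L x y z => ⟨L.comp x y z, L.eq_left x y, L.eq_right x y, L.dom_le x y, by simp⟩,
    fun h => ⟨fun x y z => (h x y z).1,
    fun x y => (h x y x).2.1,
    fun x y => (h x y x).2.2.1,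
    fun x y => (h x y x).2.2.2.1⟩⟩

/-- The equations for domain as pairs of terms. -/
def domEquations {T : Type*} (r m c : T → T → T) (d : T → T) (x y : T) : List (T × T) :=
  [(c x (d y), r (r (c x y) x) x),
    (c (d x) x, x),
    (r (d x) x, r x x),
    (r (m x y) (m (c (d x) y) x), r x x)]

theorem domLaws_iff {A : Type*} {r m c : A → A → A} {d : A → A} :
    DomLaws r m c d ↔ ∀ x y, ∀ e ∈ domEquations r m c d x y, e.1 = e.2 := by
  simp only [domEquations, List.forall_mem_cons]
  refine ⟨fun L x y => ⟨L.comp x y, L.dom_comp x, L.le_dom x, L.eq_of_comp x y, by simp⟩, fun h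
    => ⟨fun x y => (h x y).1,
    fun x => (h x x).2.1,
    fun x => (h x x).2.2.1,
    fun x y => (h x y).2.2.2.1⟩⟩

/-- The equations for antidomain as pairs of terms. -/
def antidomEquations {T : Type*} (r c : T → T → T) (d : T → T) (x y : T) : List (T × T) :=
  [(c x (d y), r (c x y) x),
    (c (d (r x x)) y, y),
    (r (d (r x x)) y, r x x)]

theorem antidomLaws_iff {A : Type*} {r c : A → A → A} {d : A → A} :
    AntidomLaws r c d ↔ ∀ x y, ∀ e ∈ antidomEquations r c d x y, e.1 = e.2 := by
  simp only [antidomEquations, List.forall_mem_cons]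
  refine ⟨fun L x y => ⟨L.comp x y, L.one_comp x y, L.le_one x y, by simp⟩, fun h => ⟨fun x y =>
    (h x y).1,
    fun x y => (h x y).2.1,
    fun x y => (h x y).2.2.1⟩⟩

variable {σ : Signature} {α : Type*}

/-- Application of a binary operation symbol to terms. -/
def tm₂ (o : Op 2) (h : (⟨2, o⟩ : Σ n, Op n) ∈ σ) (s t : (lang σ).Term α) : (lang σ).Term α :=
  (lang.sym o h).apply₂ s t

/-- Application of a unary operation symbol to a term. -/
def tm₁ (o : Op 1) (h : (⟨1, o⟩ : Σ n, Op n) ∈ σ) (s : (lang σ).Term α) : (lang σ).Term α :=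
  (lang.sym o h).apply₁ s

theorem realize_tm₂ {A : Type u} [(lang σ).Structure A] (o : Op 2)
    (h : (⟨2, o⟩ : Σ n, Op n) ∈ σ) (s t : (lang σ).Term α) (v : α → A) :
    (tm₂ o h s t).realize v = op₂ o h (s.realize v) (t.realize v) :=
  FirstOrder.Language.Term.realize_functions_apply₂

theorem realize_tm₁ {A : Type u} [(lang σ).Structure A] (o : Op 1)
    (h : (⟨1, o⟩ : Σ n, Op n) ∈ σ) (s : (lang σ).Term α) (v : α → A) :
    (tm₁ o h s).realize v = op₁ o h (s.realize v) :=
  FirstOrder.Language.Term.realize_functions_apply₁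

variable (h_arest : (⟨2, Op.arest⟩ : Σ n, Op n) ∈ σ) (h_inter : (⟨2, Op.inter⟩ : Σ n, Op n) ∈ σ)
  (h_compo : (⟨2, Op.compo⟩ : Σ n, Op n) ∈ σ)

open Classical in
/-- The equations that define the representable `σ`-algebras, as pairs of terms. -/
noncomputable def equations (x y z : (lang σ).Term α) :
    List ((lang σ).Term α × (lang σ).Term α) :=
  coreEquations (tm₂ .arest h_arest) (tm₂ .inter h_inter) (tm₂ .compo h_compo) x y z ++
  (if h : (⟨2, Op.update⟩ : Σ n, Op n) ∈ σ then updateEquations (tm₂ .arest h_arest)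
    (tm₂ .inter h_inter) (tm₂ .compo h_compo) (tm₂ .update h) x y z else []) ++
  (if h : (⟨2, Op.pref⟩ : Σ n, Op n) ∈ σ then prefEquations (tm₂ .arest h_arest)
    (tm₂ .inter h_inter) (tm₂ .compo h_compo) (tm₂ .pref h) x y z else []) ++
  (if h : (⟨1, Op.dom⟩ : Σ n, Op n) ∈ σ then domEquations (tm₂ .arest h_arest)
    (tm₂ .inter h_inter) (tm₂ .compo h_compo) (tm₁ .dom h) x y else []) ++
  (if h : (⟨1, Op.antidom⟩ : Σ n, Op n) ∈ σ then antidomEquations (tm₂ .arest h_arest)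
    (tm₂ .compo h_compo) (tm₁ .antidom h) x y else [])

theorem forall_mem_dite {β : Type*} {p : Prop} [Decidable p] {l : p → List β} {Q : β → Prop} :
    (∀ e ∈ (if h : p then l h else []), Q e) ↔ ∀ h : p, ∀ e ∈ l h, Q e := by
  split_ifs with h <;> simp [h]

/-- The equation lists are generic, so they can be read both in the algebra and among terms. The set
`V` of assignments is left free to serve both the three-variable axioms and the six-variable matrix:
it need only realise every triple of values. -/
theorem satisfiesLaws_iff {A : Type u} [(lang σ).Structure A] (x y z : (lang σ).Term α)
    {V : Set (α → A)} (hV : ∀ a b c, ∃ v ∈ V, x.realize v = a ∧ y.realize v = b ∧ z.realize v = c) :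
    SatisfiesLaws A h_arest h_inter h_compo ↔
      ∀ v ∈ V, ∀ e ∈ equations h_arest h_inter h_compo x y z, e.1.realize v = e.2.realize v := by
  have key : SatisfiesLaws A h_arest h_inter h_compo ↔ ∀ a b c : A,
      (∀ e ∈ coreEquations (op₂ .arest h_arest) (op₂ .inter h_inter) (op₂ .compo h_compo) a b c,
        e.1 = e.2) ∧
      (∀ h : (⟨2, Op.update⟩ : Σ n, Op n) ∈ σ, ∀ e ∈ updateEquations (op₂ .arest h_arest)
        (op₂ .inter h_inter) (op₂ .compo h_compo) (op₂ .update h) a b c, e.1 = e.2) ∧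
      (∀ h : (⟨2, Op.pref⟩ : Σ n, Op n) ∈ σ, ∀ e ∈ prefEquations (op₂ .arest h_arest)
        (op₂ .inter h_inter) (op₂ .compo h_compo) (op₂ .pref h) a b c, e.1 = e.2) ∧
      (∀ h : (⟨1, Op.dom⟩ : Σ n, Op n) ∈ σ, ∀ e ∈ domEquations (op₂ .arest h_arest)
        (op₂ .inter h_inter) (op₂ .compo h_compo) (op₁ .dom h) a b, e.1 = e.2) ∧
      ∀ h : (⟨1, Op.antidom⟩ : Σ n, Op n) ∈ σ, ∀ e ∈ antidomEquations (op₂ .arest h_arest)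
        (op₂ .compo h_compo) (op₁ .antidom h) a b, e.1 = e.2 := by
    constructor
    · intro L a b c
      exact ⟨coreLaws_iff.1 L.core a b c, fun h => updateLaws_iff.1 (L.update h) a b c,
        fun h => prefLaws_iff.1 (L.pref h) a b c, fun h => domLaws_iff.1 (L.dom h) a b,
        fun h => antidomLaws_iff.1 (L.antidom h) a b⟩
    · intro H
      exact ⟨coreLaws_iff.2 fun a b c => (H a b c).1,
        fun h => updateLaws_iff.2 fun a b c => (H a b c).2.1 h,
        fun h => prefLaws_iff.2 fun a b c => (H a b c).2.2.1 h,
        fun h => domLaws_iff.2 fun a b => (H a b a).2.2.2.1 h,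
        fun h => antidomLaws_iff.2 fun a b => (H a b a).2.2.2.2 h⟩
  -- The right-hand side is left open and becomes the conjunction of equations in `A` to which the
  -- left-hand side simplifies.
  have hreal : ∀ v : α → A, (∀ e ∈ equations h_arest h_inter h_compo x y z,
      e.1.realize v = e.2.realize v) ↔ _ := fun v => by
    simp only [equations, List.forall_mem_append, forall_mem_dite, coreEquations,
      updateEquations, prefEquations, domEquations, antidomEquations, List.forall_mem_cons,
      realize_tm₂, realize_tm₁, and_assoc]
    exact Iff.rfl
  rw [key]
  simp only [coreEquations, updateEquations, prefEquations, domEquations, antidomEquations,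
    List.forall_mem_cons, and_assoc]
  constructor
  · intro H v _
    rw [hreal]
    simpa using H (x.realize v) (y.realize v) (z.realize v)
  · intro H a b c
    obtain ⟨v, hv, rfl, rfl, rfl⟩ := hV a b c
    have := (hreal v).1 (H v hv)
    simpa using this

end Equations

/-! ### The finite theory and the ∀∃∀ sentence -/

section Axiomatisation

open FirstOrder.Language FirstOrder.Language.BoundedFormula

variable {σ : Signature} (h_arest : (⟨2, Op.arest⟩ : Σ n, Op n) ∈ σ)
  (h_inter : (⟨2, Op.inter⟩ : Σ n, Op n) ∈ σ) (h_compo : (⟨2, Op.compo⟩ : Σ n, Op n) ∈ σ)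

/-- A variable as a term. -/
def vr {n : ℕ} (i : Fin n) : (lang σ).Term (Empty ⊕ Fin n) := Term.var (Sum.inr i)

/-- The theory of the representable `σ`-algebras. -/
noncomputable def reprTheory : (lang σ).Theory :=
  (fun e : (lang σ).Term (Empty ⊕ Fin 3) × (lang σ).Term (Empty ⊕ Fin 3) =>
    (e.1.bdEqual e.2).alls) ''
      {e | e ∈ equations h_arest h_inter h_compo (vr 0) (vr 1) (vr 2)}

theorem finite_reprTheory : (reprTheory h_arest h_inter h_compo).Finite :=
  (List.finite_toSet _).image _

theorem isQuasiequation_of_mem_reprTheory {γ : (lang σ).Sentence}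
    (hγ : γ ∈ reprTheory h_arest h_inter h_compo) : IsQuasiequation γ := by
  obtain ⟨e, -, rfl⟩ := hγ
  exact ⟨3, [], e.1, e.2, rfl⟩

theorem model_reprTheory_iff {A : Type u} [(lang σ).Structure A] :
    A ⊨ reprTheory h_arest h_inter h_compo ↔ SatisfiesLaws A h_arest h_inter h_compo := by
  rw [satisfiesLaws_iff h_arest h_inter h_compo (vr 0) (vr 1) (vr 2)
    (V := Set.range fun xs : Fin 3 → A => Sum.elim default xs)
    fun a b c => ⟨_, ⟨![a, b, c], rfl⟩, rfl, rfl, rfl⟩, Theory.model_iff]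
  simp only [reprTheory, Set.forall_mem_image, Set.forall_mem_range, Set.mem_ofPred_eq]
  refine ⟨fun H xs e he => ?_, fun H e he => ?_⟩
  · have := H he
    rw [Sentence.Realize, realize_alls] at this
    simpa using this xs
  · rw [Sentence.Realize, realize_alls]
    intro xs
    simpa using H xs e he

section Formulas

variable {n : ℕ}

/-- The formula `s ≤ t`. -/
def leFormula (s t : (lang σ).Term (Empty ⊕ Fin n)) : (lang σ).BoundedFormula Empty n :=
  (tm₂ .arest h_arest (tm₂ .arest h_arest s t) t).bdEqual s

/-- The formula expressing that `s` is zero. -/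
def zeroFormula (s : (lang σ).Term (Empty ⊕ Fin n)) : (lang σ).BoundedFormula Empty n :=
  (tm₂ .arest h_arest s s).bdEqual s

/-- The matrix of the formula expressing that `s` is an atom, with `y` the bound variable. -/
def atomFormula (s y : (lang σ).Term (Empty ⊕ Fin n)) : (lang σ).BoundedFormula Empty n :=
  (zeroFormula h_arest s).not ⊓
    (zeroFormula h_arest y ⊔ ((leFormula h_arest y s).not ⊔ y.bdEqual s))

variable {A : Type u} [(lang σ).Structure A] (v : Empty → A) (xs : Fin n → A)
  (s t : (lang σ).Term (Empty ⊕ Fin n))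

theorem isQF_bdEqual : (s.bdEqual t).IsQF := (IsAtomic.equal s t).isQF

theorem isQF_foldr_bdEqual
    (l : List ((lang σ).Term (Empty ⊕ Fin n) × (lang σ).Term (Empty ⊕ Fin n))) :
    ((l.map fun e => Term.bdEqual e.1 e.2).foldr (· ⊓ ·) ⊤).IsQF := by
  induction l with
  | nil => exact IsQF.top
  | cons e l ih => exact (isQF_bdEqual _ _).inf ih

theorem isQF_atomFormula : (atomFormula h_arest s t).IsQF :=
  (isQF_bdEqual _ _).not.inf ((isQF_bdEqual _ _).sup ((isQF_bdEqual _ _).not.sup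
    (isQF_bdEqual _ _)))

theorem realize_leFormula : (leFormula h_arest s t).Realize v xs ↔
    Le h_arest (s.realize (Sum.elim v xs)) (t.realize (Sum.elim v xs)) := by
  simp only [leFormula, realize_bdEqual, realize_tm₂, Le, rest]

theorem realize_zeroFormula : (zeroFormula h_arest s).Realize v xs ↔
    IsZero h_arest (s.realize (Sum.elim v xs)) := by
  simp only [zeroFormula, realize_bdEqual, realize_tm₂, IsZero]

theorem realize_atomFormula : (atomFormula h_arest s t).Realize v xs ↔
    ¬ IsZero h_arest (s.realize (Sum.elim v xs)) ∧
      (¬ IsZero h_arest (t.realize (Sum.elim v xs)) →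
        Le h_arest (t.realize (Sum.elim v xs)) (s.realize (Sum.elim v xs)) →
          t.realize (Sum.elim v xs) = s.realize (Sum.elim v xs)) := by
  simp only [atomFormula, realize_inf, realize_sup, realize_not, realize_leFormula,
    realize_zeroFormula, realize_bdEqual]
  tauto

end Formulas

/-- The matrix of the sentence defining the completely representable `σ`-algebras. -/
noncomputable def complMatrix : (lang σ).BoundedFormula Empty 6 :=
  ((equations h_arest h_inter h_compo (vr 0) (vr 1) (vr 2)).map
      fun e => e.1.bdEqual e.2).foldr (· ⊓ ·) ⊤ ⊓
    ((leFormula h_arest (vr 0) (vr 1) ⊔ (atomFormula h_arest (vr 3) (vr 5) ⊓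
        (leFormula h_arest (vr 3) (vr 0) ⊓ (leFormula h_arest (vr 3) (vr 1)).not))) ⊓
      (leFormula h_arest (tm₂ .compo h_compo (vr 0) (vr 1)) (vr 2) ⊔
        (atomFormula h_arest (vr 4) (vr 5) ⊓ (leFormula h_arest (vr 4) (vr 1) ⊓
          (leFormula h_arest (tm₂ .compo h_compo (vr 0) (vr 4)) (vr 2)).not))))

theorem isQF_complMatrix : (complMatrix h_arest h_inter h_compo).IsQF := by
  refine IsQF.inf ?_ (IsQF.inf ?_ ?_)
  · exact isQF_foldr_bdEqual _
  · exact (isQF_bdEqual _ _).sup ((isQF_atomFormula _ _ _).inf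
      ((isQF_bdEqual _ _).inf (isQF_bdEqual _ _).not))
  · exact (isQF_bdEqual _ _).sup ((isQF_atomFormula _ _ _).inf
      ((isQF_bdEqual _ _).inf (isQF_bdEqual _ _).not))

/-- The sentence defining the completely representable `σ`-algebras. -/
noncomputable def complSentence : (lang σ).Sentence :=
  (complMatrix h_arest h_inter h_compo).all.ex.ex.all.all.all

theorem isForallExistsForall_complSentence :
    IsForallExistsForall (complSentence h_arest h_inter h_compo) :=
  .all <| .all <| .all <| .of_isExistsForall <| .ex <| .ex <| .of_isUniversal <|
    .all (isQF_complMatrix h_arest h_inter h_compo).isUniversal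

/-- In the matrix, variables 0, 1, 2 are `a`, `b`, `c`, variables 3 and 4 are the witnessing atoms
`s` and `t`, and variable 5 tests both for minimality. Distributivity enters contrapositively: if `a
∘ b` is not below `c`, some atom `t ≤ b` has `a ∘ t` not below `c`. -/
theorem realize_complSentence_iff {A : Type u} [Nonempty A] [(lang σ).Structure A] :
    A ⊨ complSentence h_arest h_inter h_compo ↔ SatisfiesLaws A h_arest h_inter h_compo ∧
      AtomsSeparating A h_arest ∧ CompLeftDistribAtoms A h_arest h_compo := by
  have hreal : A ⊨ complSentence h_arest h_inter h_compo ↔ ∀ a b c : A, ∃ s t : A, ∀ y : A,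
      (complMatrix h_arest h_inter h_compo).Realize default ![a, b, c, s, t, y] := by
    have hsnoc : ∀ a b c s t y : A, (Fin.snoc (Fin.snoc (Fin.snoc (Fin.snoc (Fin.snoc
        (Fin.snoc default a) b) c) s) t) y : Fin 6 → A) = ![a, b, c, s, t, y] := by
      intro a b c s t y
      funext i
      fin_cases i <;> rfl
    simp only [Sentence.Realize, Formula.Realize, complSentence, realize_all, realize_ex]
    simp only [← hsnoc]
  have hmat : ∀ a b c s t y : A,
      (complMatrix h_arest h_inter h_compo).Realize default ![a, b, c, s, t, y] ↔
      (∀ e ∈ equations h_arest h_inter h_compo (vr 0) (vr 1) (vr 2),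
        e.1.realize (Sum.elim default ![a, b, c, s, t, y]) =
          e.2.realize (Sum.elim default ![a, b, c, s, t, y])) ∧
      (Le h_arest a b ∨ (¬ IsZero h_arest s ∧ (¬ IsZero h_arest y → Le h_arest y s → y = s)) ∧
        Le h_arest s a ∧ ¬ Le h_arest s b) ∧
      (Le h_arest (op₂ .compo h_compo a b) c ∨
        (¬ IsZero h_arest t ∧ (¬ IsZero h_arest y → Le h_arest y t → y = t)) ∧
        Le h_arest t b ∧ ¬ Le h_arest (op₂ .compo h_compo a t) c) := by
    intro a b c s t y
    simp only [complMatrix, realize_inf, realize_sup, realize_not, realize_leFormula,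
      realize_atomFormula, realize_tm₂, realize_foldr_inf, List.forall_mem_map, realize_bdEqual]
    exact Iff.rfl
  simp only [hreal, hmat]
  constructor
  · intro H
    refine ⟨?_, fun a b hab => ?_, fun a b c h => ?_⟩
    -- With `V` the assignments that satisfy the equations, it remains to extend each triple to a
    -- member of `V`, which `H` does.
    · refine (satisfiesLaws_iff h_arest h_inter h_compo (vr 0) (vr 1) (vr 2)
        (V := {v : Empty ⊕ Fin 6 → A | ∀ e ∈ equations h_arest h_inter h_compo (vr 0) (vr 1)
          (vr 2), e.1.realize v = e.2.realize v}) fun a b c => ?_).2 fun v hv => hv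
      obtain ⟨s, t, h⟩ := H a b c
      exact ⟨_, (h a).1, rfl, rfl, rfl⟩
    · obtain ⟨s, t, h⟩ := H a b a
      have hs := fun y => (h y).2.1.resolve_left hab
      exact ⟨s, ⟨(hs a).1.1, fun y => (hs y).1.2⟩, (hs a).2⟩
    · obtain ⟨s, t, h'⟩ := H a b c
      by_contra hc
      have ht := fun y => (h' y).2.2.resolve_left hc
      exact (ht a).2.2 (h t ⟨(ht a).1.1, fun y => (ht y).1.2⟩ (ht a).2.1)
  · rintro ⟨L, hsep, hd⟩ a b c
    have hL := (satisfiesLaws_iff (A := A) h_arest h_inter h_compo (vr (n := 6) 0) (vr 1) (vr 2)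
      (V := Set.univ) fun a b c =>
        ⟨Sum.elim default ![a, b, c, a, a, a], trivial, rfl, rfl, rfl⟩).1 L
    -- The witness is chosen before `y`; when `a ≤ b` no atom is needed and any value, such as `a`,
    -- will do.
    have hs : ∃ s, Le h_arest a b ∨
        IsAtomElt h_arest s ∧ Le h_arest s a ∧ ¬ Le h_arest s b := by
      by_cases hab : Le h_arest a b
      · exact ⟨a, Or.inl hab⟩
      · exact (hsep a b hab).imp fun s => Or.inr
    have ht : ∃ t, Le h_arest (op₂ .compo h_compo a b) c ∨
        IsAtomElt h_arest t ∧ Le h_arest t b ∧ ¬ Le h_arest (op₂ .compo h_compo a t) c := by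
      by_contra! hno
      exact (hno a).1 (hd a b c fun x hx => (hno x).2 hx)
    obtain ⟨s, hs⟩ := hs
    obtain ⟨t, ht⟩ := ht
    exact ⟨s, t, fun y => ⟨hL _ trivial, hs.imp_right fun h => ⟨⟨h.1.1, h.1.2 y⟩, h.2⟩,
      ht.imp_right fun h => ⟨⟨h.1.1, h.1.2 y⟩, h.2⟩⟩⟩

end Axiomatisation

end PartialFunctions

open PartialFunctions in
theorem mainTheorem1 (σ : Signature)
    (h_arest : (⟨2, Op.arest⟩ : Σ n, Op n) ∈ σ)
    (h_compo : (⟨2, Op.compo⟩ : Σ n, Op n) ∈ σ)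
    (h_inter : (⟨2, Op.inter⟩ : Σ n, Op n) ∈ σ) :
    ∃ (Γ : (lang σ).Theory) (φ : (lang σ).Sentence),
      Γ.Finite ∧ (∀ γ ∈ Γ, IsQuasiequation γ) ∧ IsForallExistsForall φ ∧
      ∀ (A : Type u) [Nonempty A] [(lang σ).Structure A],
        (A ⊨ φ ↔ MeetCompletelyRepresentable A h_arest) ∧
        (A ⊨ φ ↔ JoinCompletelyRepresentable A h_arest) ∧
        (A ⊨ Γ ↔ Representable σ A) ∧
        (A ⊨ φ ↔ A ⊨ Γ ∧ AtomsSeparating A h_arest ∧ CompLeftDistribAtoms A h_arest h_compo) ∧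
        (A ⊨ φ ↔ A ⊨ Γ ∧ AtomsSeparating A h_arest ∧ CompLeftDistribJoins A h_arest h_compo) := by
  refine ⟨reprTheory h_arest h_inter h_compo, complSentence h_arest h_inter h_compo,
    finite_reprTheory h_arest h_inter h_compo,
    fun γ => isQuasiequation_of_mem_reprTheory h_arest h_inter h_compo,
    isForallExistsForall_complSentence h_arest h_inter h_compo, fun A _ _ => ?_⟩
  rw [meetCompletelyRepresentable_iff h_inter, joinCompletelyRepresentable_iff h_inter h_compo,
    ← satisfiesLaws_iff_representable (h_arest := h_arest) (h_inter := h_inter)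
      (h_compo := h_compo), realize_complSentence_iff, model_reprTheory_iff]
  refine ⟨Iff.rfl, Iff.rfl, Iff.rfl, Iff.rfl,
    and_congr_right fun L => and_congr_right fun hsep => ?_⟩
  -- Any representation, complete or not, suffices to compare the two forms of distributivity.
  obtain ⟨X, θ, R, -⟩ := L.exists_isRep
  exact R.compLeftDistribAtoms_iff h_arest h_compo h_inter hsep
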